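/- Let $d,q\ge 1$ be integers, $n=dq$, and $\zeta_k=\exp(2i\pi/k)$ for $k\ge 1$. Let $G(d,1,q)\subset \mathrm{GL}_q(\mathbb C)$ be the group of monomial $q\times q$ matrices whose nonzero entries are $d$-th roots of unity. Call $r\in G(d,1,q)$ a reflection if its fixed space is a hyperplane; let $\ell(w)$ be the minimal length of a decomposition of $w\in G(d,1,q)$ as a product of reflections of $G(d,1,q)$, and write $v\preceq w$ if $\ell(v)+\ell(v^{-1}w)=\ell(w)$. Let $c=c(d,1,q)\in G(d,1,q)$ be the Coxeter element with $c\,e_i=e_{i+1}$ for $1\le i<q$ and $c\,e_q=\zeta_d e_1$, and let $I_{c}(G(d,1,q))=\{w\in G(d,1,q) : w\preceq c\}$, ordered by $\preceq$. The group $G(d,1,q)$ permutes the $n$ vectors $\zeta_d^j e_i$ ($0\le j<d$, $1\le i\le q$); identifying $\zeta_d^j e_i$ with the vertex $\zeta_n^{\,i-1+qj}$ of the regular $n$-gon formed by the $n$-th roots of unity, we obtain an embedding of $G(d,1,q)$ in the symmetric group $\mathfrak S_n$ on the vertices. A partition of the set of vertices is noncrossing if the convex hulls of its distinct parts are pairwise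 disjoint; let $\mathrm{NCP}(1,1,n)$ be the set of noncrossing partitions, ordered by refinement ($P\le Q$ if every part of $P$ is contained in a part of $Q$), and let $\mathrm{NCP}(d,1,q)=\mathrm{NCP}(1,1,n)^{\mu_d}$ be the subposet of those partitions whose set of parts is preserved by multiplication by every $d$-th root of unity. Then the map that sends an element of $G(d,1,q)$ to the partition of the vertices into the orbits of (the cyclic group generated by) its image in $\mathfrak S_n$ restricts to a poset isomorphism from $I_{c(d,1,q)}(G(d,1,q))$ onto $\mathrm{NCP}(d,1,q)$. -/

import Mathlib

open scoped Pointwise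

noncomputable section

/-- `zetaRoot d = exp (2 i π / d)`, the standard primitive `d`-th root of unity. -/
def zetaRoot (d : ℕ) : ℂ := Complex.exp (2 * Real.pi * Complex.I / d)

theorem zetaRoot_primitive (d : ℕ) [NeZero d] : IsPrimitiveRoot (zetaRoot d) d :=
  Complex.isPrimitiveRoot_exp d (NeZero.ne d)

/-! ### Reflection length, absolute order, intervals -/

/-- A (complex, pseudo-)reflection: an element whose fixed space is a hyperplane. -/
def IsComplexReflection {m : ℕ} (r : GL (Fin m) ℂ) : Prop :=
  ((r : Matrix (Fin m) (Fin m) ℂ) - 1).rank = 1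

/-- The reflection length of `w` in `W`: the minimal length of a decomposition of `w` as a product
of reflections of `W`. -/
def reflectionLength {m : ℕ} (W : Subgroup (GL (Fin m) ℂ)) (w : W) : ℕ :=
  sInf {k | ∃ l : List W,
    (∀ r ∈ l, IsComplexReflection (r : GL (Fin m) ℂ)) ∧ l.prod = w ∧ l.length = k}

/-- The relation `v ≼ w` on `W`, that is `ℓ(v) + ℓ(v⁻¹ w) = ℓ(w)`. -/
def AbsoluteLE {m : ℕ} (W : Subgroup (GL (Fin m) ℂ)) (v w : W) : Prop :=
  reflectionLength W v + reflectionLength W (v⁻¹ * w) = reflectionLength W w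

/-- The interval `I_c(W) = {w ∈ W | w ≼ c}`. -/
structure AbsoluteInterval {m : ℕ} (W : Subgroup (GL (Fin m) ℂ)) (c : W) where
  /-- the underlying element of `W` -/
  val : W
  le_top : AbsoluteLE W val c

instance {m : ℕ} (W : Subgroup (GL (Fin m) ℂ)) (c : W) : LE (AbsoluteInterval W c) where
  le v w := AbsoluteLE W v.val w.val

/-! ### The group `G(d,1,q)` and its Coxeter element -/

/-- The matrix sending the basis vector `e_j` to `a j • e_(σ j)`. -/
def monomialMatrix {q : ℕ} (σ : Equiv.Perm (Fin q)) (a : Fin q → ℂ) : Matrix (Fin q) (Fin q) ℂ :=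
  Matrix.of fun i j => if i = σ j then a j else 0

theorem monomialMatrix_mul {q : ℕ} (σ τ : Equiv.Perm (Fin q)) (a b : Fin q → ℂ) :
    monomialMatrix σ a * monomialMatrix τ b
      = monomialMatrix (σ * τ) (fun j => a (τ j) * b j) := by
  ext i j
  simp only [monomialMatrix, Matrix.mul_apply, Matrix.of_apply, Equiv.Perm.mul_apply]
  rw [Finset.sum_eq_single (τ j) (fun k _ hk => by simp [hk]) (by simp)]
  by_cases h : i = σ (τ j) <;> simp [h]

theorem monomialMatrix_one {q : ℕ} : monomialMatrix (1 : Equiv.Perm (Fin q)) (fun _ => 1) = 1 := by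
  ext i j
  rw [Matrix.one_apply]
  by_cases h : i = j <;> simp [monomialMatrix, h]

theorem monomialMatrix_mulVec_single {q : ℕ} (σ : Equiv.Perm (Fin q)) (a : Fin q → ℂ)
    (j : Fin q) (x : ℂ) :
    (monomialMatrix σ a).mulVec (Pi.single j x) = Pi.single (σ j) (a j * x) := by
  ext i
  by_cases h : i = σ j
  · subst h
    simp [monomialMatrix]
  · simp [monomialMatrix, h]

/-- `G(d,1,q)`: the monomial matrices of size `q` whose nonzero entries are `d`-th roots of
unity. -/
def monomialGroup (d q : ℕ) [NeZero d] : Subgroup (GL (Fin q) ℂ) where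
  carrier := {g | ∃ (σ : Equiv.Perm (Fin q)) (a : Fin q → ℂ),
    (∀ j, a j ^ d = 1) ∧ (g : Matrix (Fin q) (Fin q) ℂ) = monomialMatrix σ a}
  one_mem' := ⟨1, fun _ => 1, by simp, by simp [monomialMatrix_one]⟩
  mul_mem' := by
    rintro g h ⟨σ, a, ha, hg⟩ ⟨τ, b, hb, hh⟩
    exact ⟨σ * τ, fun j => a (τ j) * b j, fun j => by simp [mul_pow, ha, hb], by
      rw [Units.val_mul, hg, hh, monomialMatrix_mul]⟩
  inv_mem' := by
    rintro g ⟨σ, a, ha, hg⟩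
    refine ⟨σ⁻¹, fun j => (a (σ⁻¹ j))⁻¹, fun j => by simp [ha], ?_⟩
    have ha0 : ∀ j, a j ≠ 0 := fun j h => by
      have := ha j
      rw [h, zero_pow (NeZero.ne d)] at this
      exact zero_ne_one this
    have key : (g : Matrix (Fin q) (Fin q) ℂ)
        * monomialMatrix σ⁻¹ (fun j => (a (σ⁻¹ j))⁻¹) = 1 := by
      rw [hg, monomialMatrix_mul, ← monomialMatrix_one]
      congr 1
      · simp
      · funext j
        exact mul_inv_cancel₀ (ha0 _)
    exact Units.inv_eq_of_mul_eq_one_right key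

/-- The entries of the Coxeter element: all `1` except `ζ_d` in the last column. -/
def coxeterEntry (d q : ℕ) (j : Fin q) : ℂ := if (j : ℕ) + 1 = q then zetaRoot d else 1

theorem coxeterEntry_pow (d q : ℕ) [NeZero d] (j : Fin q) : coxeterEntry d q j ^ d = 1 := by
  unfold coxeterEntry
  split_ifs
  · exact (zetaRoot_primitive d).pow_eq_one
  · simp

theorem coxeterMatrix_isUnit (d q : ℕ) [NeZero d] :
    IsUnit (monomialMatrix (finRotate q) (coxeterEntry d q)) := by
  have h0 : ∀ j, coxeterEntry d q j ≠ 0 := fun j h => by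
    have := coxeterEntry_pow d q j
    rw [h, zero_pow (NeZero.ne d)] at this
    exact zero_ne_one this
  refine IsUnit.of_mul_eq_one (monomialMatrix (finRotate q)⁻¹
    (fun j => (coxeterEntry d q ((finRotate q)⁻¹ j))⁻¹)) ?_
  rw [monomialMatrix_mul, ← monomialMatrix_one]
  congr 1
  · simp
  · funext j
    exact mul_inv_cancel₀ (h0 _)

/-- The Coxeter element `c(d,1,q)` of `G(d,1,q)`: it sends `e_1 ↦ e_2 ↦ ⋯ ↦ e_q ↦ ζ_d e_1`. -/
def coxeterElement (d q : ℕ) [NeZero d] : monomialGroup d q :=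
  ⟨(coxeterMatrix_isUnit d q).unit, finRotate q, coxeterEntry d q, coxeterEntry_pow d q, rfl⟩

/-! ### The embedding of `G(d,1,q)` in the symmetric group on `n = d q` letters

The letter `e(j,i)` stands for the vector `ζ_d ^ j • e_i`; the letters are numbered
`e(0,1), …, e(0,q), e(1,1), …, e(d-1,q)`, and `G(d,1,q)` acts by its linear action on vectors. -/

/-- The vectors `x • e_i` of `ℂ ^ q`, where `x` is a `d`-th root of unity. -/
def monomialPoints (d q : ℕ) : Set (Fin q → ℂ) :=
  {v | ∃ (x : ℂ) (i : Fin q), x ^ d = 1 ∧ v = Pi.single i x}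

instance (d q : ℕ) [NeZero d] : MulAction (monomialGroup d q) (monomialPoints d q) where
  smul g v := ⟨(g.1 : Matrix (Fin q) (Fin q) ℂ).mulVec v.1, by
    obtain ⟨_, x, i, hx, rfl⟩ := v
    obtain ⟨_, σ, a, ha, hg⟩ := g
    exact ⟨a i * x, σ i, by simp [mul_pow, ha, hx], by
      rw [hg, monomialMatrix_mulVec_single]⟩⟩
  one_smul v := Subtype.ext (Matrix.one_mulVec v.1)
  mul_smul g h v := Subtype.ext (Matrix.mulVec_mulVec v.1 _ _).symm

theorem monomialPoint_bijective (d q : ℕ) [NeZero d] :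
    Function.Bijective (fun p : Fin d × Fin q =>
      (⟨Pi.single p.2 (zetaRoot d ^ (p.1 : ℕ)), _, p.2, by
        rw [← pow_mul, mul_comm, pow_mul, (zetaRoot_primitive d).pow_eq_one, one_pow], rfl⟩ :
        monomialPoints d q)) := by
  have hz := zetaRoot_primitive d
  constructor
  · rintro ⟨j, i⟩ ⟨j', i'⟩ h
    have h1 : (Pi.single i (zetaRoot d ^ (j : ℕ)) : Fin q → ℂ)
        = Pi.single i' (zetaRoot d ^ (j' : ℕ)) := congrArg Subtype.val h
    have hne : zetaRoot d ^ (j : ℕ) ≠ 0 := pow_ne_zero _ (hz.ne_zero (NeZero.ne d))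
    have h2 := congrFun h1 i
    have hi : i = i' := by
      by_contra hi
      simp [hi] at h2
      exact hne (by simp [h2])
    subst hi
    rw [Pi.single_eq_same, Pi.single_eq_same] at h2
    have := hz.pow_inj j.2 j'.2 h2
    exact Prod.ext (Fin.ext this) rfl
  · rintro ⟨_, x, i, hx, rfl⟩
    obtain ⟨k, hk, rfl⟩ := hz.eq_pow_of_pow_eq_one hx
    exact ⟨(⟨k, hk⟩, i), rfl⟩

/-- The numbering of the letters: the letter `ζ_d ^ j • e_i` gets the number `i + q j`, where
`0 ≤ j < d` and `0 ≤ i < q`. -/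
def monomialPointEquiv (d q : ℕ) [NeZero d] : monomialPoints d q ≃ Fin (d * q) :=
  (Equiv.ofBijective _ (monomialPoint_bijective d q)).symm.trans finProdFinEquiv

/-- The embedding of `G(d,1,q)` in the symmetric group on `n = d q` letters. -/
def embedPerm (d q : ℕ) [NeZero d] : monomialGroup d q →* Equiv.Perm (Fin (d * q)) :=
  (monomialPointEquiv d q).permCongrHom.toMonoidHom.comp
    (MulAction.toPermHom (monomialGroup d q) (monomialPoints d q))

/-- The partition of the `n` letters given by the orbits of (the group generated by) the image of
`g` in the symmetric group. Partitions are encoded as equivalence relations. -/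
def orbitPartition (d q : ℕ) [NeZero d] (g : monomialGroup d q) : Setoid (Fin (d * q)) :=
  Equiv.Perm.SameCycle.setoid (embedPerm d q g)

/-! ### Noncrossing partitions of the regular `n`-gon -/

/-- The vertex of number `k` of the regular `n`-gon formed by the `n`-th roots of unity. -/
def polygonVertex (n : ℕ) (k : Fin n) : ℂ := zetaRoot n ^ (k : ℕ)

/-- The parts of a partition of the vertices of the regular `n`-gon, as subsets of the plane. -/
def polygonParts {n : ℕ} (P : Setoid (Fin n)) : Set (Set ℂ) :=
  (fun A => polygonVertex n '' A) '' P.classes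

/-- A partition of the regular `n`-gon is noncrossing if the convex hulls of distinct parts are
disjoint. -/
def IsNoncrossing {n : ℕ} (P : Setoid (Fin n)) : Prop :=
  (polygonParts P).PairwiseDisjoint (fun A => convexHull ℝ A)

/-- A partition of the regular `n`-gon is `μ_d`-invariant if multiplication by any `d`-th root of
unity maps parts to parts. -/
def IsMuInvariant (d : ℕ) {n : ℕ} (P : Setoid (Fin n)) : Prop :=
  ∀ ζ : ℂ, ζ ^ d = 1 → ∀ A ∈ polygonParts P, ζ • A ∈ polygonParts P

/-- `NCP(1,1,n)`, the noncrossing partitions of the regular `n`-gon, ordered by refinement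
(the order of `Setoid`: `P ≤ Q` if every part of `P` lies in a part of `Q`). -/
abbrev NCP (n : ℕ) : Type := {P : Setoid (Fin n) // IsNoncrossing P}

/-- `NCP(d,1,q) = NCP(1,1,n)^{μ_d}` for `n = d q`, with the induced order. -/
abbrev NCPInvariant (d q : ℕ) : Type := {P : NCP (d * q) // IsMuInvariant d P.1}

end

/-! ### Ranks of `A - 1` -/

/-! Everything is reduced to linear algebra. In `G(d,1,q)` the reflection length of `w` is the rank
of `w - 1` (`reflectionLength_eq_rank`), so `v ≼ w` says that these ranks add up for `w = v * (v⁻¹ *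
w)`. In the numbering of the letters, `c` acts as the long cycle `k ↦ k + 1`.

The link with noncrossing partitions is the notion of arc shift (`IsArcShift`): whenever `a` and
`a'` are in the same cycle, `[a, a')` is mapped into, hence onto, `(a, a']`. Orbits cannot leave
such arcs without meeting the cycle of `a`, so the cycles of an arc shift do not cross.

Elements below `c` are arc shifts. If `v * u = c` in the symmetric group and the ranks of `v - 1`
and `u - 1` on `ℂ ^ n` have sum less than `n`, a dimension count shows that `u` fixes the indicator
of `[a, a')`, so `v` acts on it as `c` does (`isArcShift_of_rank_add_lt`). The bound on `ℂ ^ n`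
comes from `ℂ ^ q`: passing to `ℂ ^ n` multiplies ranks by at most `d`, and equality forces the
product of the nonzero entries to be `1`; since this product is `ζ_d` for `c`, equality cannot hold
throughout (`rank_permutationMatrix_add_lt`). The same bound shows that `v ≼ w ≼ c` makes the cycles
of `v` refine those of `w`.

Conversely, if `v` and `w` are arc shifts and the cycles of `v` refine those of `w`, then `v` and
`w` agree on the sum of the letters in `[a, b)` for `b = v a`. Such sums provide enough fixed
vectors of `v⁻¹ * w` for the ranks to add up (`absoluteLE_of_isArcShift`). With `w = c`, every arc
shift in the image of the group lies below `c`.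

For surjectivity, the map sending each vertex to the next one of its block along `c` is an arc shift
with the prescribed cycles. It commutes with the rotations by `d`-th roots of unity, hence comes
from `G(d,1,q)`. -/

theorem finrank_map_add_finrank_inf_ker {K V W : Type*} [Field K] [AddCommGroup V] [Module K V]
    [AddCommGroup W] [Module K W] [FiniteDimensional K V] (f : V →ₗ[K] W) (S : Submodule K V) :
    Module.finrank K (S.map f) + Module.finrank K (S ⊓ LinearMap.ker f : Submodule K V)
      = Module.finrank K S := by
  rw [← LinearMap.finrank_range_add_finrank_ker (f.domRestrict S), LinearMap.range_domRestrict,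
    LinearMap.ker_domRestrict, ← Submodule.map_comap_subtype,
    Submodule.finrank_map_subtype_eq]

theorem Matrix.rank_add_le_add {K l m : Type*} [Field K] [Fintype l] [Fintype m]
    (A B : Matrix l m K) : (A + B).rank ≤ A.rank + B.rank := by
  rw [Matrix.rank, Matrix.mulVecLin_add]
  refine (Submodule.finrank_mono (LinearMap.range_add_le _ _)).trans ?_
  exact Submodule.finrank_add_le_finrank_add_finrank _ _

section

variable {K m : Type*} [Field K] [Fintype m] [DecidableEq m]

/-- The space of the vectors fixed by `A`. -/
def Matrix.fixedSpace (A : Matrix m m K) : Submodule K (m → K) := LinearMap.ker (A - 1).mulVecLin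

theorem Matrix.rank_add_finrank_fixedSpace (A : Matrix m m K) :
    (A - 1).rank + Module.finrank K A.fixedSpace = Fintype.card m := by
  exact (LinearMap.finrank_range_add_finrank_ker (A - 1).mulVecLin).trans (by simp)

theorem Matrix.mem_fixedSpace {A : Matrix m m K} {x : m → K} :
    x ∈ A.fixedSpace ↔ A.mulVec x = x := by
  simp [Matrix.fixedSpace, sub_eq_zero]

theorem Matrix.rank_mul_sub_one_le (A B : Matrix m m K) :
    (A * B - 1).rank ≤ (A - 1).rank + (B - 1).rank := by
  have : A * B - 1 = (A - 1) * B + (B - 1) := by noncomm_ring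
  rw [this]
  exact (Matrix.rank_add_le_add _ _).trans (Nat.add_le_add_right (Matrix.rank_mul_le_left _ _) _)

/-- If `rank (A - 1)` and `rank (B - 1)` add up to `rank (A * B - 1)`, every vector fixed by
`A * B` is fixed by `A`. -/
theorem Matrix.mulVec_eq_of_rank_add_le {A B : Matrix m m K}
    (h : (A - 1).rank + (B - 1).rank ≤ (A * B - 1).rank) {x : m → K}
    (hx : (A * B).mulVec x = x) : A.mulVec x = x := by
  have hle : A.fixedSpace ⊓ B.fixedSpace ≤ (A * B).fixedSpace := by
    rintro y ⟨hy1, hy2⟩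
    rw [Matrix.mem_fixedSpace, ← Matrix.mulVec_mulVec, Matrix.mem_fixedSpace.1 hy2,
      Matrix.mem_fixedSpace.1 hy1]
  have h1 := Matrix.rank_add_finrank_fixedSpace A
  have h2 := Matrix.rank_add_finrank_fixedSpace B
  have h3 := Matrix.rank_add_finrank_fixedSpace (A * B)
  have h4 := Submodule.finrank_sup_add_finrank_inf_eq A.fixedSpace B.fixedSpace
  have h5 : Module.finrank K (A.fixedSpace ⊔ B.fixedSpace : Submodule K (m → K)) ≤ Fintype.card m := by
    simpa using Submodule.finrank_le (A.fixedSpace ⊔ B.fixedSpace)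
  -- The rank inequality bounds the dimension of the space fixed by `A * B` by `dim Fix A + dim Fix
  -- B - card m`, which is at most the dimension of the intersection.
  have := Submodule.eq_of_le_of_finrank_le hle (by omega)
  have hx' : x ∈ A.fixedSpace ⊓ B.fixedSpace := by
    rw [this]; exact Matrix.mem_fixedSpace.2 hx
  exact Matrix.mem_fixedSpace.1 hx'.1

/-- A criterion for the additivity of `rank (A - 1)` and `rank (U - 1)` in a product. -/
theorem Matrix.rank_add_le_of_forall_exists {A U B : Matrix m m K} (hAU : A * U = B)
    (hA : Function.Injective A.mulVec) (hfix : ∀ x, B.mulVec x = x → A.mulVec x = x)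
    (hex : ∀ i, ∃ x, A.mulVec x = B.mulVec x ∧
      B.mulVec x - x = A.mulVec (Pi.single i 1) - Pi.single i 1) :
    (A - 1).rank + (U - 1).rank ≤ (B - 1).rank := by
  have hS : ∀ x, A.mulVec x = B.mulVec x → x ∈ U.fixedSpace := fun x hx => by
    refine Matrix.mem_fixedSpace.2 (hA ?_)
    rw [Matrix.mulVec_mulVec, hAU, hx]
  -- The vectors `x` of `hex` are fixed by `U`, and `B - 1` maps them to the columns of `A - 1`.
  -- Since `Fix B ≤ Fix U`, rank-nullity for `B - 1` on `Fix U` gives `rank (A - 1) ≤ dim Fix U -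
  -- dim Fix B`, which is the claim.
  have hmap : LinearMap.range (A - 1).mulVecLin ≤ U.fixedSpace.map (B - 1).mulVecLin := by
    rw [Matrix.range_mulVecLin, Submodule.span_le]
    rintro _ ⟨i, rfl⟩
    obtain ⟨x, hx1, hx2⟩ := hex i
    refine ⟨x, hS x hx1, ?_⟩
    rw [Matrix.mulVecLin_apply, Matrix.sub_mulVec, Matrix.one_mulVec, hx2]
    simp only [← Matrix.mulVec_single_one, Matrix.sub_mulVec, Matrix.one_mulVec]
  have hker : B.fixedSpace ≤ U.fixedSpace := fun x hx => by
    have := Matrix.mem_fixedSpace.1 hx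
    exact hS x ((hfix x this).trans this.symm)
  have h1 := finrank_map_add_finrank_inf_ker (B - 1).mulVecLin U.fixedSpace
  rw [show LinearMap.ker (B - 1).mulVecLin = B.fixedSpace from rfl,
    inf_eq_right.2 hker] at h1
  have h2 := Submodule.finrank_mono hmap
  have h3 := Matrix.rank_add_finrank_fixedSpace B
  have h4 := Matrix.rank_add_finrank_fixedSpace U
  have h5 : (A - 1).rank = Module.finrank K (LinearMap.range (A - 1).mulVecLin) := rfl
  omega

/-- If `A * U = C` has additive ranks, the image under `C - 1` of the space fixed by `U` contains
the range of `A - 1`. -/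
theorem Matrix.exists_fixed_of_rank_add_lt {A U C : Matrix m m K} (hAU : A * U = C)
    (h : (A - 1).rank + (U - 1).rank < Fintype.card m)
    (hC : Module.finrank K (C.fixedSpace) ≤ 1) {y : m → K}
    (hy : y ∈ LinearMap.range (A - 1).mulVecLin) :
    ∃ x, U.mulVec x = x ∧ C.mulVec x - x = y := by
  have hmap : U.fixedSpace.map (C - 1).mulVecLin ≤ LinearMap.range (A - 1).mulVecLin := by
    rintro _ ⟨x, hx, rfl⟩
    refine ⟨x, ?_⟩
    have := Matrix.mem_fixedSpace.1 hx
    simp only [Matrix.mulVecLin_apply, Matrix.sub_mulVec, ← hAU, ← Matrix.mulVec_mulVec, this]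
  have h1 := finrank_map_add_finrank_inf_ker (C - 1).mulVecLin U.fixedSpace
  rw [show LinearMap.ker (C - 1).mulVecLin = C.fixedSpace from rfl] at h1
  have h2 := Submodule.finrank_mono
    (inf_le_right : U.fixedSpace ⊓ C.fixedSpace ≤ C.fixedSpace)
  have h4 := Matrix.rank_add_finrank_fixedSpace U
  have h5 : (A - 1).rank = Module.finrank K (LinearMap.range (A - 1).mulVecLin) := rfl
  -- The kernel of `C - 1` on `Fix U` has dimension at most `1`, so the image has dimension at least
  -- `card m - rank (U - 1) - 1`. The strict inequality `h` makes this at least `rank (A - 1)`.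
  have := Submodule.eq_of_le_of_finrank_le hmap (by omega)
  rw [← this] at hy
  obtain ⟨x, hx, rfl⟩ := hy
  exact ⟨x, Matrix.mem_fixedSpace.1 hx, by simp⟩

end

/-! ### Reflection length in `G(d,1,q)` -/

section

variable {d q : ℕ} [NeZero d]

/-- The matrix of an element of `G(d,1,q)`. -/
abbrev monomialGroup.matrix (g : monomialGroup d q) : Matrix (Fin q) (Fin q) ℂ :=
  (g.1 : Matrix (Fin q) (Fin q) ℂ)

open monomialGroup

theorem ne_zero_of_pow_eq_one {x : ℂ} (hx : x ^ d = 1) : x ≠ 0 := by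
  rintro rfl
  rw [zero_pow (NeZero.ne d)] at hx
  exact zero_ne_one hx

theorem monomialMatrix_mulVec_apply (σ : Equiv.Perm (Fin q)) (a x : Fin q → ℂ) (j : Fin q) :
    (monomialMatrix σ a).mulVec x (σ j) = a j * x j := by
  simp [monomialMatrix, Matrix.mulVec, dotProduct]

theorem exists_matrix_eq (σ : Equiv.Perm (Fin q)) {a : Fin q → ℂ} (ha : ∀ j, a j ^ d = 1) :
    ∃ g : monomialGroup d q, matrix g = monomialMatrix σ a := by
  have h : IsUnit (monomialMatrix σ a) := by
    refine IsUnit.of_mul_eq_one (monomialMatrix σ⁻¹ (fun j => (a (σ⁻¹ j))⁻¹)) ?_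
    rw [monomialMatrix_mul, ← monomialMatrix_one]
    congr 1
    · simp
    · funext j
      exact mul_inv_cancel₀ (ne_zero_of_pow_eq_one (ha _))
  exact ⟨⟨h.unit, σ, a, ha, rfl⟩, rfl⟩

theorem exists_matrix_mulVec_single (g : monomialGroup d q) (i : Fin q) :
    ∃ k a, a ^ d = 1 ∧ (matrix g).mulVec (Pi.single i 1) = Pi.single k a := by
  obtain ⟨g, σ, a, ha, hg⟩ := g
  exact ⟨σ i, a i, ha i, by simp only [matrix, hg, monomialMatrix_mulVec_single, mul_one]⟩

/-- An element of `G(d,1,q)` mapping a multiple of a basis vector to a multiple of a basis vector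
acts accordingly on the coordinates. -/
theorem matrix_mulVec_apply (g : monomialGroup d q) {i k : Fin q} {a b : ℂ} (hb : b ≠ 0)
    (h : (matrix g).mulVec (Pi.single i a) = Pi.single k b) (x : Fin q → ℂ) :
    a * (matrix g).mulVec x k = b * x i := by
  obtain ⟨g, σ, c, hc, hg⟩ := g
  simp only [matrix] at h ⊢
  rw [hg, monomialMatrix_mulVec_single] at h
  have hk : σ i = k := by
    by_contra hk
    have := congrFun h k
    rw [Pi.single_eq_same, Pi.single_eq_of_ne (Ne.symm hk)] at this
    exact hb this.symm
  subst hk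
  rw [Pi.single_inj] at h
  rw [hg, monomialMatrix_mulVec_apply, ← h]
  ring

theorem matrix_one : matrix (1 : monomialGroup d q) = 1 := rfl

theorem matrix_mul (g h : monomialGroup d q) : matrix (g * h) = matrix g * matrix h := rfl

theorem matrix_injective : Function.Injective (matrix (d := d) (q := q)) := fun _ _ h =>
  Subtype.ext (Units.ext h)

theorem matrix_mulVec_injective (g : monomialGroup d q) :
    Function.Injective (matrix g).mulVec := by
  intro x y h
  have := congrArg (matrix g⁻¹).mulVec h
  simpa only [Matrix.mulVec_mulVec, ← matrix_mul, inv_mul_cancel, matrix_one,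
    Matrix.one_mulVec] using this

theorem inv_mulVec_eq_of_mulVec_eq {g : monomialGroup d q} {x y : Fin q → ℂ}
    (h : (matrix g).mulVec x = y) : (matrix g⁻¹).mulVec y = x := by
  rw [← h, Matrix.mulVec_mulVec, ← matrix_mul, inv_mul_cancel, matrix_one, Matrix.one_mulVec]

theorem eq_one_of_rank_eq_zero {g : monomialGroup d q} (h : (matrix g - 1).rank = 0) : g = 1 := by
  refine matrix_injective ?_
  rw [matrix_one, ← sub_eq_zero]
  rw [Matrix.rank, Submodule.finrank_eq_zero, LinearMap.range_eq_bot] at h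
  exact Matrix.ext_of_mulVec_single fun i => 
    (LinearMap.congr_fun h (Pi.single i 1)).trans (Matrix.zero_mulVec _).symm

/-- For a letter `a • e_k` other than `e_i`, some reflection maps `e_i` to `a • e_k` and fixes every
vector `x` with `x k = a * x i`. -/
theorem exists_reflection {i k : Fin q} {a : ℂ} (ha : a ^ d = 1)
    (hne : (Pi.single k a : Fin q → ℂ) ≠ Pi.single i 1) :
    ∃ r : monomialGroup d q, IsComplexReflection r.1 ∧
      (matrix r).mulVec (Pi.single i 1) = Pi.single k a ∧
      ∀ x : Fin q → ℂ, x k = a * x i → (matrix r).mulVec x = x := by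
  have ha0 := ne_zero_of_pow_eq_one ha
  obtain ⟨r, hr⟩ := exists_matrix_eq (d := d) (Equiv.swap i k)
    -- For `k = i` the swap is trivial and the first branch wins: the matrix is diagonal and
    -- multiplies `e_i` by `a`.
    (a := fun j => if j = i then a else if j = k then a⁻¹ else 1) (by
      intro j
      split_ifs <;> simp [ha])
  have hi : (matrix r).mulVec (Pi.single i 1) = Pi.single k a := by
    rw [hr, monomialMatrix_mulVec_single]
    simp
  have hfix : ∀ x : Fin q → ℂ, x k = a * x i → (matrix r).mulVec x = x := by
    intro x hx
    funext l
    obtain ⟨j, rfl⟩ := (Equiv.swap i k).surjective l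
    rw [hr, monomialMatrix_mulVec_apply]
    rcases eq_or_ne j i with rfl | hji
    · simp [hx]
    rcases eq_or_ne j k with rfl | hjk
    · simp [hji, hx, ha0]
    · simp [hji, hjk, Equiv.swap_apply_of_ne_of_ne hji hjk]
  refine ⟨r, ?_, hi, hfix⟩
  have hle : (matrix r - 1).rank ≤ 1 := by
    let φ : (Fin q → ℂ) →ₗ[ℂ] ℂ := LinearMap.proj k - a • LinearMap.proj i
    have h1 : LinearMap.ker φ ≤ (matrix r).fixedSpace := fun x hx =>
      Matrix.mem_fixedSpace.2 (hfix x (by simpa [φ, sub_eq_zero] using hx))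
    have h2 := LinearMap.finrank_range_add_finrank_ker φ
    have h3 := (matrix r).rank_add_finrank_fixedSpace
    have h4 := Submodule.finrank_mono h1
    have h5 := (LinearMap.range φ).finrank_le
    simp only [Module.finrank_self, Module.finrank_fintype_fun_eq_card] at h2 h5
    omega
  refine le_antisymm hle (Nat.one_le_iff_ne_zero.2 fun h0 => hne ?_)
  rw [← hi, eq_one_of_rank_eq_zero h0, matrix_one, Matrix.one_mulVec]

theorem rank_sub_one_le_length (l : List (monomialGroup d q))
    (hl : ∀ r ∈ l, IsComplexReflection (r : GL (Fin q) ℂ)) :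
    (matrix l.prod - 1).rank ≤ l.length := by
  induction l with
  | nil => simp [matrix_one]
  | cons r l ih =>
    rw [List.prod_cons, matrix_mul, List.length_cons, add_comm]
    refine (Matrix.rank_mul_sub_one_le _ _).trans (Nat.add_le_add ?_ ?_)
    · exact (hl r (by simp)).le
    · exact ih fun s hs => hl s (by simp [hs])

theorem exists_reflection_list (n : ℕ) (w : monomialGroup d q) (hw : (matrix w - 1).rank ≤ n) :
    ∃ l : List (monomialGroup d q),
      (∀ r ∈ l, IsComplexReflection (r : GL (Fin q) ℂ)) ∧ l.prod = w ∧ l.length ≤ n := by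
  induction n generalizing w with
  | zero => exact ⟨[], by simp, by simp [eq_one_of_rank_eq_zero (Nat.le_zero.1 hw)], le_rfl⟩
  | succ n ih =>
    by_cases hw1 : w = 1
    · exact ⟨[], by simp, by simp [hw1], Nat.zero_le _⟩
    obtain ⟨i, hi⟩ : ∃ i, (matrix w).mulVec (Pi.single i 1) ≠ Pi.single i 1 := by
      by_contra! h
      refine hw1 (matrix_injective ?_)
      ext j i
      have := congrFun (h i) j
      rw [Matrix.mulVec_single_one] at this
      rw [matrix_one, Matrix.one_apply]
      simpa [Pi.single_apply] using this
    obtain ⟨k, a, ha, hik⟩ := exists_matrix_mulVec_single w i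
    obtain ⟨r, hr, hri, hrfix⟩ := exists_reflection ha (hik ▸ hi)
    -- A vector `x` fixed by `w` satisfies `x k = a * x i`, hence is fixed by `r`. So `r⁻¹ * w`
    -- keeps all fixed vectors of `w` and gains `e_i`: one reflection lowers the rank.
    have hlt : (matrix w).fixedSpace < (matrix (r⁻¹ * w)).fixedSpace := by
      refine lt_of_le_of_ne (fun x hx => ?_) fun h => ?_
      · rw [Matrix.mem_fixedSpace] at hx ⊢
        have := matrix_mulVec_apply w (ne_zero_of_pow_eq_one ha) hik x
        rw [hx, one_mul] at this
        rw [matrix_mul, ← Matrix.mulVec_mulVec, hx]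
        exact inv_mulVec_eq_of_mulVec_eq (hrfix x this)
      · have : (Pi.single i 1 : Fin q → ℂ) ∈ (matrix (r⁻¹ * w)).fixedSpace := by
          rw [Matrix.mem_fixedSpace, matrix_mul, ← Matrix.mulVec_mulVec, hik]
          exact inv_mulVec_eq_of_mulVec_eq hri
        rw [← h, Matrix.mem_fixedSpace] at this
        exact hi this
    have h1 := Submodule.finrank_lt_finrank_of_lt hlt
    have h2 := (matrix w).rank_add_finrank_fixedSpace
    have h3 := (matrix (r⁻¹ * w)).rank_add_finrank_fixedSpace
    obtain ⟨l, hl, hlp, hln⟩ := ih (r⁻¹ * w) (by omega)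
    refine ⟨r :: l, ?_, by simp [hlp], by simpa using hln⟩
    exact List.forall_mem_cons.2 ⟨hr, hl⟩

theorem reflectionLength_eq_rank (w : monomialGroup d q) :
    reflectionLength (monomialGroup d q) w = (matrix w - 1).rank := by
  obtain ⟨l, hl, hlw, hln⟩ := exists_reflection_list _ w le_rfl
  unfold reflectionLength
  refine le_antisymm (le_trans (Nat.sInf_le ⟨l, hl, hlw, rfl⟩) hln) ?_
  refine le_csInf ⟨l.length, l, hl, hlw, rfl⟩ ?_
  rintro _ ⟨l', hl', rfl, rfl⟩
  exact rank_sub_one_le_length l' hl'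

/-- The reverse inequality is the subadditivity of `rank (A - 1)`, so only one direction ever has to
be checked. -/
theorem absoluteLE_iff {v w : monomialGroup d q} :
    AbsoluteLE (monomialGroup d q) v w ↔
      (matrix v - 1).rank + (matrix (v⁻¹ * w) - 1).rank ≤ (matrix w - 1).rank := by
  rw [AbsoluteLE, reflectionLength_eq_rank, reflectionLength_eq_rank, reflectionLength_eq_rank]
  refine ⟨le_of_eq, fun h => le_antisymm h ?_⟩
  have := Matrix.rank_mul_sub_one_le (matrix v) (matrix (v⁻¹ * w))
  rwa [← matrix_mul, mul_inv_cancel_left] at this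

theorem absoluteLE_antisymm {v w : monomialGroup d q} (h1 : AbsoluteLE (monomialGroup d q) v w)
    (h2 : AbsoluteLE (monomialGroup d q) w v) : v = w := by
  rw [absoluteLE_iff] at h1 h2
  -- Adding the two inequalities leaves rank `0` for `v⁻¹ * w - 1`.
  exact (inv_mul_eq_one.1 (eq_one_of_rank_eq_zero (by omega)))

end

/-! ### Permutation matrices and the cyclic permutation -/

section

variable {n : ℕ}

/-- The matrix of a permutation. -/
def permutationMatrix (v : Equiv.Perm (Fin n)) : Matrix (Fin n) (Fin n) ℂ :=
  monomialMatrix v fun _ => 1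

theorem permutationMatrix_mul (v u : Equiv.Perm (Fin n)) :
    permutationMatrix (v * u) = permutationMatrix v * permutationMatrix u := by
  simp [permutationMatrix, monomialMatrix_mul]

theorem permutationMatrix_mulVec_apply (v : Equiv.Perm (Fin n)) (x : Fin n → ℂ) (k : Fin n) :
    (permutationMatrix v).mulVec x (v k) = x k := by
  rw [permutationMatrix, monomialMatrix_mulVec_apply, one_mul]

theorem permutationMatrix_mulVec_single (v : Equiv.Perm (Fin n)) (k : Fin n) (z : ℂ) :
    (permutationMatrix v).mulVec (Pi.single k z) = Pi.single (v k) z := by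
  rw [permutationMatrix, monomialMatrix_mulVec_single, one_mul]

theorem permutationMatrix_mulVec_eq_self_iff {v : Equiv.Perm (Fin n)} {x : Fin n → ℂ} :
    (permutationMatrix v).mulVec x = x ↔ ∀ k, x (v k) = x k := by
  rw [funext_iff, ← v.forall_congr_right]
  simp only [permutationMatrix_mulVec_apply, eq_comm]

theorem permutationMatrix_mulVec_eq_self_of_sameCycle {v : Equiv.Perm (Fin n)} {x : Fin n → ℂ}
    (hx : ∀ k l, v.SameCycle k l → x k = x l) : (permutationMatrix v).mulVec x = x :=
  permutationMatrix_mulVec_eq_self_iff.2 fun k => hx _ _ (by simp [Equiv.Perm.SameCycle.refl])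

/-- A permutation `v` such that `[a, a')` is mapped into `(a, a']` whenever `a` and `a'` are in the
same cycle of `v`. -/
def IsArcShift (v : Equiv.Perm (Fin n)) : Prop :=
  ∀ a b a' : Fin n, v.SameCycle a a' → a ≤ b → b < a' → a < v b ∧ v b ≤ a'

variable {c : Equiv.Perm (Fin n)} (hc : ∀ k l : Fin n, (k : ℕ) + 1 = l → c k = l)

include hc in
theorem eq_of_cyclic_invariant {α : Type*} {x : Fin n → α} (hx : ∀ k, x (c k) = x k)
    (k l : Fin n) : x k = x l := by
  have h0 : ∀ m (hm : m < n), x ⟨m, hm⟩ = x ⟨0, by omega⟩ := by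
    intro m
    induction m with
    | zero => exact fun _ => rfl
    | succ m ih =>
      intro hm
      rw [← ih (by omega), ← hx ⟨m, by omega⟩]
      exact congrArg x (hc _ _ rfl).symm
  exact (h0 k k.2).trans (h0 l l.2).symm

include hc in
theorem sameCycle_cyclic (k l : Fin n) : c.SameCycle k l := by
  have := eq_of_cyclic_invariant hc (x := fun m => c.SameCycle k m) (fun m => by simp) k l
  exact this.mp (Equiv.Perm.SameCycle.refl _ _)

include hc in
-- The hypothesis on `c` says nothing about the last point, but `0` must have a preimage and no
-- other point is available.
theorem cyclic_eq_zero {k l : Fin n} (hk : (k : ℕ) + 1 = n) (hl : (l : ℕ) = 0) : c k = l := by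
  obtain ⟨s, hs⟩ := c.surjective l
  by_cases hsn : (s : ℕ) + 1 = n
  · rwa [show k = s from Fin.ext (by omega)]
  · have := hc s ⟨s + 1, by omega⟩ rfl
    rw [hs] at this
    rw [this] at hl
    simp at hl

include hc in
theorem finrank_fixedSpace_cyclic_le :
    Module.finrank ℂ (permutationMatrix c).fixedSpace ≤ 1 := by
  have : (permutationMatrix c).fixedSpace ≤ Submodule.span ℂ {fun _ => 1} := by
    intro x hx
    rw [Matrix.mem_fixedSpace, permutationMatrix_mulVec_eq_self_iff] at hx
    rw [Submodule.mem_span_singleton]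
    rcases Nat.eq_zero_or_pos n with rfl | hn
    · exact ⟨0, Subsingleton.elim _ _⟩
    · exact ⟨x ⟨0, hn⟩, funext fun k => by
        simpa using eq_of_cyclic_invariant hc hx ⟨0, hn⟩ k⟩
  exact (Submodule.finrank_mono this).trans (finrank_span_le_card _ |>.trans (by simp))

/-- The differences of consecutive points of the cycle are columns of the matrix, up to order; they
telescope from `a` to `b`. -/
theorem single_sub_single_mem_range {v : Equiv.Perm (Fin n)} {a b : Fin n}
    (h : v.SameCycle a b) :
    (Pi.single b 1 - Pi.single a 1 : Fin n → ℂ)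
      ∈ LinearMap.range (permutationMatrix v - 1).mulVecLin := by
  obtain ⟨k, rfl⟩ := h.exists_nat_pow_eq
  clear h
  induction k with
  | zero => simp
  | succ k ih =>
    rw [← sub_add_sub_cancel _ (Pi.single ((v ^ k) a) 1 : Fin n → ℂ)]
    refine Submodule.add_mem _ ⟨Pi.single ((v ^ k) a) 1, ?_⟩ ih
    rw [Matrix.mulVecLin_apply, Matrix.sub_mulVec, Matrix.one_mulVec,
      permutationMatrix_mulVec_single, pow_succ', Equiv.Perm.mul_apply]

include hc in
/-- The factors `v` of the cyclic permutation with additive ranks are arc shifts. -/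
theorem isArcShift_of_rank_add_lt {v u : Equiv.Perm (Fin n)} (hvu : v * u = c)
    (h : (permutationMatrix v - 1).rank + (permutationMatrix u - 1).rank < n) :
    IsArcShift v := by
  intro a b a' haa' hab hba'
  have hmul : permutationMatrix v * permutationMatrix u = permutationMatrix c := by
    rw [← permutationMatrix_mul, hvu]
  obtain ⟨x, hux, hcx⟩ := Matrix.exists_fixed_of_rank_add_lt hmul (by simpa using h)
    (finrank_fixedSpace_cyclic_le hc) (single_sub_single_mem_range haa')
  -- The cyclic permutation turns the indicator of `[a, a')` into that of `(a, a']`, so `y` solves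
  -- the same equation as `x`. The two solutions differ by a constant vector, which `u` fixes; hence
  -- `u` fixes `y` as well.
  let y : Fin n → ℂ := fun t => if a ≤ t ∧ t < a' then 1 else 0
  have hcy : (permutationMatrix c).mulVec y - y = Pi.single a' 1 - Pi.single a 1 := by
    funext l
    obtain ⟨t, rfl⟩ := c.surjective l
    simp only [Pi.sub_apply, permutationMatrix_mulVec_apply, Pi.single_apply, y]
    by_cases ht : (t : ℕ) + 1 = n
    · have h0 := cyclic_eq_zero hc (l := ⟨0, by omega⟩) ht rfl
      simp only [h0, Fin.le_def, Fin.lt_def, Fin.ext_iff] at *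
      split_ifs <;> first | omega | simp
    · have h0 := hc t ⟨t + 1, by omega⟩ rfl
      simp only [h0, Fin.le_def, Fin.lt_def, Fin.ext_iff] at *
      split_ifs <;> first | omega | simp
  have hconst : (permutationMatrix c).mulVec (x - y) = x - y := by
    rw [Matrix.mulVec_sub, ← sub_eq_zero, sub_sub_sub_comm, hcx, hcy, sub_self]
  rw [permutationMatrix_mulVec_eq_self_iff] at hconst
  have huy : (permutationMatrix u).mulVec y = y := by
    have : (permutationMatrix u).mulVec (x - y) = x - y :=
      permutationMatrix_mulVec_eq_self_of_sameCycle fun k l _ =>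
        eq_of_cyclic_invariant hc hconst k l
    rw [Matrix.mulVec_sub, hux] at this
    exact sub_right_injective this
  have hvy : (permutationMatrix v).mulVec y = (permutationMatrix c).mulVec y := by
    rw [← hmul, ← Matrix.mulVec_mulVec, huy]
  have h1 := congrFun hvy (v b)
  obtain ⟨s, hs⟩ := c.surjective (v b)
  rw [permutationMatrix_mulVec_apply, ← hs, permutationMatrix_mulVec_apply] at h1
  have h2 : a ≤ s ∧ s < a' := by
    by_contra hcon
    simp [y, hcon, hab, hba'] at h1
  have h3 := hc s ⟨s + 1, by have := h2.2; omega⟩ rfl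
  have h4 := Fin.le_def.1 h2.1
  have h5 := Fin.lt_def.1 h2.2
  rw [← hs, h3]
  simp only [Fin.lt_def, Fin.le_def]
  omega

/-- The cycles of the factors with additive ranks refine the cycles of the product. -/
theorem sameCycle_of_rank_add_le {v u : Equiv.Perm (Fin n)}
    (h : (permutationMatrix v - 1).rank + (permutationMatrix u - 1).rank
      ≤ (permutationMatrix (v * u) - 1).rank) {a b : Fin n} (hab : v.SameCycle a b) :
    (v * u).SameCycle a b := by
  classical
  rw [permutationMatrix_mul] at h
  -- The indicator of the cycle of `a` under the product is fixed by the product, hence by `v`, so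
  -- the `v`-cycle of `a` stays inside it.
  let x : Fin n → ℂ := fun k => if (v * u).SameCycle a k then 1 else 0
  have hx : (permutationMatrix v * permutationMatrix u).mulVec x = x := by
    rw [← permutationMatrix_mul]
    refine permutationMatrix_mulVec_eq_self_of_sameCycle fun k l hkl => ?_
    have : (v * u).SameCycle a k ↔ (v * u).SameCycle a l :=
      ⟨fun h => h.trans hkl, fun h => h.trans hkl.symm⟩
    simp only [x, this]
  have hvx := permutationMatrix_mulVec_eq_self_iff.1 (Matrix.mulVec_eq_of_rank_add_le h hx)
  obtain ⟨k, rfl⟩ := hab.exists_nat_pow_eq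
  have hk : x ((v ^ k) a) = x a := by
    clear hab
    induction k with
    | zero => rfl
    | succ k ih => rw [pow_succ', Equiv.Perm.mul_apply, hvx, ih]
  by_contra hcon
  simp [x, hcon, Equiv.Perm.SameCycle.refl] at hk

end

/-! ### The letters -/

section

open monomialGroup

variable {d q : ℕ} [NeZero d]

/-- The vector `ζ_d ^ j • e_i` of number `k = i + q j`. -/
noncomputable def letter (d q : ℕ) [NeZero d] (k : Fin (d * q)) : Fin q → ℂ :=
  ((monomialPointEquiv d q).symm k).1

theorem matrix_mulVec_letter (g : monomialGroup d q) (k : Fin (d * q)) :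
    (matrix g).mulVec (letter d q k) = letter d q (embedPerm d q g k) :=
  congrArg Subtype.val ((monomialPointEquiv d q).symm_apply_apply
    (g • (monomialPointEquiv d q).symm k)).symm

theorem letter_injective : Function.Injective (letter d q) :=
  Subtype.val_injective.comp (monomialPointEquiv d q).symm.injective

theorem letter_finProdFinEquiv (j : Fin d) (i : Fin q) :
    letter d q (finProdFinEquiv (j, i)) = Pi.single i (zetaRoot d ^ (j : ℕ)) := by
  simp [letter, monomialPointEquiv]

theorem letter_eq_of_val {k : Fin (d * q)} {i : Fin q} {j : ℕ} (h : (k : ℕ) = i + q * j) :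
    letter d q k = Pi.single i (zetaRoot d ^ j) := by
  have hj : j < d := by
    by_contra! hj
    have := Nat.mul_le_mul_left q hj
    have := k.2.trans_eq (mul_comm d q)
    omega
  rw [← letter_finProdFinEquiv ⟨j, hj⟩ i]
  exact congrArg _ (Fin.ext h)

theorem exists_letter_eq (i : Fin q) {x : ℂ} (hx : x ^ d = 1) :
    ∃ k, letter d q k = Pi.single i x := by
  obtain ⟨j, hj, rfl⟩ := (zetaRoot_primitive d).eq_pow_of_pow_eq_one hx
  exact ⟨_, letter_finProdFinEquiv ⟨j, hj⟩ i⟩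

theorem exists_letter_single (k : Fin (d * q)) :
    ∃ i x, x ^ d = 1 ∧ letter d q k = Pi.single i x := by
  obtain ⟨x, i, hx, h⟩ := ((monomialPointEquiv d q).symm k).2
  exact ⟨i, x, hx, h⟩

theorem embedPerm_coxeterElement (k l : Fin (d * q)) (h : (k : ℕ) + 1 = l) :
    embedPerm d q (coxeterElement d q) k = l := by
  apply letter_injective
  rw [← matrix_mulVec_letter]
  obtain ⟨⟨j, i⟩, rfl⟩ := finProdFinEquiv.surjective k
  have hk : ((finProdFinEquiv (j, i) : Fin (d * q)) : ℕ) = i + q * j := rfl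
  rw [letter_finProdFinEquiv, show matrix (coxeterElement d q) = _ from rfl]
  change (monomialMatrix (finRotate q) (coxeterEntry d q)).mulVec _ = _
  rw [monomialMatrix_mulVec_single]
  obtain ⟨m, rfl⟩ : ∃ m, q = m + 1 := ⟨q - 1, by have := i.2; omega⟩
  by_cases hi : (i : ℕ) = m
  · have h1 : i = ⟨m, by omega⟩ := Fin.ext hi
    rw [h1, finRotate_last', coxeterEntry, if_pos rfl, ← pow_succ']
    refine (letter_eq_of_val ?_).symm
    simp only [← h, hk]
    rw [hi]
    ring
  · have h1 : i = ⟨(i : ℕ), by omega⟩ := rfl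
    rw [h1, finRotate_of_lt (by omega), coxeterEntry, if_neg (by simpa using hi), one_mul]
    refine (letter_eq_of_val ?_).symm
    simp only [← h, hk]
    ring

/-! ### Comparison of the ranks on `ℂ ^ q` and `ℂ ^ n` -/

/-- A row vector fixed by `g` is an invariant linear form. Such forms separate cycles of letters and
so bound their number from below. -/
theorem dotProduct_letter_of_sameCycle {g : monomialGroup d q} {y : Fin q → ℂ}
    (hy : Matrix.vecMul y (matrix g) = y) {k l : Fin (d * q)}
    (h : (embedPerm d q g).SameCycle k l) : y ⬝ᵥ letter d q k = y ⬝ᵥ letter d q l := by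
  obtain ⟨m, rfl⟩ := h.exists_nat_pow_eq
  clear h
  induction m with
  | zero => rfl
  | succ m ih =>
    rw [ih, pow_succ', Equiv.Perm.mul_apply, ← matrix_mulVec_letter, Matrix.dotProduct_mulVec, hy]

/-- Some coordinates restrict to coordinates of a subspace of `K ^ m`. -/
theorem Submodule.exists_coordinates {K m : Type*} [Field K] [Finite m]
    (S : Submodule K (m → K)) : ∃ (n : ℕ) (a : Fin n → m),
      n = Module.finrank K S ∧ ∀ t : Fin n → K, ∃ y ∈ S, ∀ k, y (a k) = t k := by
  cases nonempty_fintype m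
  let ev : m → Module.Dual K S := fun i => LinearMap.proj i ∘ₗ S.subtype
  obtain ⟨κ, a, ha, hspan, hli⟩ := exists_linearIndependent' K ev
  have : Finite κ := Finite.of_injective a ha
  cases nonempty_fintype κ
  let R : S →ₗ[K] (κ → K) := LinearMap.pi fun k => ev (a k)
  have hinj : Function.Injective R := by
    rw [injective_iff_map_eq_zero]
    intro y hy
    -- A maximal independent family of coordinate forms spans all of them, so a vector of `S` on
    -- which the family vanishes is zero.
    have h1 : Submodule.span K (Set.range (ev ∘ a)) ≤ LinearMap.ker (Module.Dual.eval K S y) := by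
      rw [Submodule.span_le]
      rintro _ ⟨k, rfl⟩
      exact congrFun hy k
    rw [hspan] at h1
    refine Subtype.ext (funext fun i => ?_)
    exact h1 (Submodule.subset_span ⟨i, rfl⟩)
  have h1 := LinearMap.finrank_le_finrank_of_injective hinj
  have h2 := hli.fintype_card_le_finrank
  rw [Subspace.dual_finrank_eq] at h2
  rw [Module.finrank_fintype_fun_eq_card] at h1
  have hcard : Fintype.card κ = Module.finrank K S := le_antisymm h2 h1
  have hsurj : Function.Surjective R :=
    (LinearMap.injective_iff_surjective_of_finrank_eq_finrank (by simp [hcard])).1 hinj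
  let e := (Fintype.equivFin κ).symm
  refine ⟨Fintype.card κ, a ∘ e, hcard, fun t => ?_⟩
  obtain ⟨y, hy⟩ := hsurj (t ∘ e.symm)
  exact ⟨y.1, y.2, fun k => (congrFun hy (e k)).trans (by simp)⟩

/-- Comparison of the ranks of an element of `G(d,1,q)` on `ℂ ^ q` and `ℂ ^ n`. -/
theorem rank_permutationMatrix_embedPerm (g : monomialGroup d q) :
    (permutationMatrix (embedPerm d q g) - 1).rank ≤ d * (matrix g - 1).rank ∧
      ((permutationMatrix (embedPerm d q g) - 1).rank = d * (matrix g - 1).rank →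
        ∃ y : Fin q → ℂ, Matrix.vecMul y (matrix g) = y ∧ ∀ i, y i ≠ 0) := by
  classical
  set v := embedPerm d q g with hv
  -- The invariant linear forms have dimension `m = q - rank (g - 1)` and take arbitrary values on
  -- the `e_(a k)`.
  obtain ⟨m, a, hm, hS⟩ := (Matrix.fixedSpace (matrix g).transpose).exists_coordinates
  simp only [Matrix.mem_fixedSpace, Matrix.mulVec_transpose] at hS
  have hmr := Matrix.rank_add_finrank_fixedSpace (matrix g).transpose
  rw [← hm, ← Matrix.transpose_one, ← Matrix.transpose_sub, Matrix.rank_transpose,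
    Fintype.card_fin] at hmr
  let L : Fin d × Fin m → Fin (d * q) := fun p => finProdFinEquiv (p.1, a p.2)
  have hL : ∀ (y : Fin q → ℂ) p, y ⬝ᵥ letter d q (L p) = y (a p.2) * zetaRoot d ^ (p.1 : ℕ) :=
    fun y p => by rw [letter_finProdFinEquiv, dotProduct_single]
  have hz := zetaRoot_primitive d
  have hz0 : ∀ j : ℕ, zetaRoot d ^ j ≠ 0 := fun j => pow_ne_zero _ (hz.ne_zero (NeZero.ne d))
  -- The `d * m` letters `ζ_d ^ j • e_(a k)` lie in distinct cycles: a form equal to `1` on one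
  -- `e_(a k)` and to `0` on the others tells them apart. So `v` has at least `d * m` cycles.
  have hLinj : ∀ p p', v.SameCycle (L p) (L p') → p = p' := by
    rintro ⟨j, k⟩ ⟨j', k'⟩ h
    obtain ⟨y, hy, hyk⟩ := hS (Pi.single k 1)
    have h1 := dotProduct_letter_of_sameCycle hy h
    rw [hL, hL, hyk, hyk, Pi.single_eq_same, one_mul] at h1
    have hk : k' = k := by
      by_contra hk
      rw [Pi.single_eq_of_ne hk, zero_mul] at h1
      exact hz0 _ h1
    subst hk
    rw [Pi.single_eq_same, one_mul] at h1
    rw [Fin.ext (hz.pow_inj j.2 j'.2 h1)]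
  let ind : Fin (d * q) → Fin (d * q) → ℂ := fun k l => if v.SameCycle k l then 1 else 0
  have hind : ∀ k, ind k ∈ (permutationMatrix v).fixedSpace := by
    intro k
    refine Matrix.mem_fixedSpace.2 (permutationMatrix_mulVec_eq_self_of_sameCycle ?_)
    intro l l' hl
    have : v.SameCycle k l ↔ v.SameCycle k l' := ⟨fun h => h.trans hl, fun h => h.trans hl.symm⟩
    simp only [ind, this]
  let S : (permutationMatrix v).fixedSpace →ₗ[ℂ] (Fin d × Fin m → ℂ) :=
    LinearMap.funLeft ℂ ℂ L ∘ₗ Submodule.subtype _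
  have hsurj : Function.Surjective S := by
    intro t
    refine ⟨⟨∑ p, t p • ind (L p), Submodule.sum_mem _ fun p _ =>
      Submodule.smul_mem _ _ (hind _)⟩, funext fun p => ?_⟩
    have : ∀ p', v.SameCycle (L p') (L p) ↔ p' = p :=
      fun p' => ⟨hLinj _ _, fun h => h ▸ Equiv.Perm.SameCycle.refl _ _⟩
    simp [S, ind, LinearMap.funLeft_apply, this]
  have hr := Matrix.rank_add_finrank_fixedSpace (permutationMatrix v)
  rw [Fintype.card_fin] at hr
  have hle := LinearMap.finrank_le_finrank_of_surjective hsurj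
  simp only [Module.finrank_fintype_fun_eq_card, Fintype.card_prod, Fintype.card_fin] at hle
  have hd : d * (matrix g - 1).rank + d * m = d * q := by rw [← mul_add, hmr]
  refine ⟨by omega, fun heq => ?_⟩
  -- If the ranks agree, evaluation at these letters is injective on the vectors fixed by `v`, so
  -- every cycle meets them. The form equal to `1` on all `e_(a k)` then takes a power of `ζ_d` as
  -- its value on every `e_i`.
  have hinj : Function.Injective S :=
    (LinearMap.injective_iff_surjective_of_finrank_eq_finrank (by simp; omega)).2 hsurj
  obtain ⟨y, hy, hyk⟩ := hS fun _ => 1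
  refine ⟨y, hy, fun i => ?_⟩
  obtain ⟨l, hl⟩ := exists_letter_eq (d := d) i (one_pow d)
  have hex : ∃ p, v.SameCycle l (L p) := by
    by_contra! hcon
    have : (⟨ind l, hind l⟩ : (permutationMatrix v).fixedSpace) = 0 :=
      hinj (funext fun p => by simp [S, ind, LinearMap.funLeft_apply, hcon])
    have := congrFun (congrArg Subtype.val this) l
    simp [ind, Equiv.Perm.SameCycle.refl] at this
  obtain ⟨p, hp⟩ := hex
  have h1 := dotProduct_letter_of_sameCycle hy hp
  rw [hL, hyk, one_mul, hl, dotProduct_single, mul_one] at h1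
  rw [h1]
  exact hz0 _

/-- The product of the column sums, which is the product of the nonzero entries of a monomial
matrix. -/
def colSumProd (M : Matrix (Fin q) (Fin q) ℂ) : ℂ := ∏ j, ∑ i, M i j

theorem colSumProd_monomialMatrix (σ : Equiv.Perm (Fin q)) (a : Fin q → ℂ) :
    colSumProd (monomialMatrix σ a) = ∏ j, a j := by
  simp [colSumProd, monomialMatrix]

theorem colSumProd_matrix_mul (g h : monomialGroup d q) :
    colSumProd (matrix (g * h)) = colSumProd (matrix g) * colSumProd (matrix h) := by
  obtain ⟨g, σ, a, ha, hg⟩ := g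
  obtain ⟨h, τ, b, hb, hh⟩ := h
  rw [matrix_mul]
  simp only [matrix]
  rw [hg, hh, monomialMatrix_mul]
  simp only [colSumProd_monomialMatrix, Finset.prod_mul_distrib, Equiv.prod_comp τ a]

theorem colSumProd_eq_one {g : monomialGroup d q} {y : Fin q → ℂ}
    (hy : Matrix.vecMul y (matrix g) = y) (hy0 : ∀ i, y i ≠ 0) : colSumProd (matrix g) = 1 := by
  obtain ⟨g, σ, a, ha, hg⟩ := g
  simp only [matrix] at hy ⊢
  rw [hg] at hy ⊢
  rw [colSumProd_monomialMatrix]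
  have h1 : ∀ j, y (σ j) * a j = y j := fun j => by
    conv_rhs => rw [← hy]
    simp [monomialMatrix, Matrix.vecMul, dotProduct]
  have h2 : ∏ j, y j ≠ 0 := Finset.prod_ne_zero_iff.2 fun j _ => hy0 j
  -- Multiplying the equations `y (σ j) * a j = y j` over all `j` only permutes the factors `y j`.
  have h3 : (∏ j, y j) * ∏ j, a j = ∏ j, y j := by
    rw [← Equiv.prod_comp σ y, ← Finset.prod_mul_distrib, Equiv.prod_comp σ y]
    exact Finset.prod_congr rfl fun j _ => h1 j
  exact mul_left_cancel₀ h2 (h3.trans (mul_one _).symm)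

theorem colSumProd_coxeterElement [NeZero q] :
    colSumProd (matrix (coxeterElement d q)) = zetaRoot d := by
  change colSumProd (monomialMatrix (finRotate q) (coxeterEntry d q)) = _
  have hq := NeZero.pos q
  rw [colSumProd_monomialMatrix, Finset.prod_eq_single ⟨q - 1, by omega⟩]
  · simp only [coxeterEntry]
    rw [if_pos (by omega)]
  · intro j _ hj
    rw [coxeterEntry, if_neg]
    rw [Ne, Fin.ext_iff] at hj
    simp only at hj
    omega
  · simp

theorem rank_coxeterElement_lt (q : ℕ) [NeZero q] :
    (matrix (coxeterElement 1 q) - 1).rank < q := by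
  have h : (fun _ => 1) ∈ (matrix (coxeterElement 1 q)).fixedSpace := by
    rw [Matrix.mem_fixedSpace]
    change (monomialMatrix (finRotate q) (coxeterEntry 1 q)).mulVec _ = _
    funext k
    obtain ⟨j, rfl⟩ := (finRotate q).surjective k
    rw [monomialMatrix_mulVec_apply, ← pow_one (coxeterEntry 1 q j), coxeterEntry_pow, one_mul]
  have h1 := Matrix.rank_add_finrank_fixedSpace (matrix (coxeterElement 1 q))
  rw [Fintype.card_fin] at h1
  have h2 : Module.finrank ℂ (matrix (coxeterElement 1 q)).fixedSpace ≠ 0 := by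
    intro h0
    rw [Submodule.finrank_eq_zero] at h0
    rw [h0, Submodule.mem_bot] at h
    exact one_ne_zero (congrFun h ⟨0, NeZero.pos q⟩)
  omega

/-- The ranks on `ℂ ^ n` of the factors of a reduced factorization of the Coxeter element. -/
theorem rank_permutationMatrix_add_lt [NeZero q] {v u t : monomialGroup d q}
    (hc : v * u * t = coxeterElement d q)
    (h : (matrix v - 1).rank + (matrix u - 1).rank + (matrix t - 1).rank
      ≤ (matrix (coxeterElement d q) - 1).rank) :
    (permutationMatrix (embedPerm d q v) - 1).rank +
      (permutationMatrix (embedPerm d q u) - 1).rank +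
      (permutationMatrix (embedPerm d q t) - 1).rank < d * q := by
  by_contra! hcon
  obtain ⟨hv, hv'⟩ := rank_permutationMatrix_embedPerm v
  obtain ⟨hu, hu'⟩ := rank_permutationMatrix_embedPerm u
  obtain ⟨ht, ht'⟩ := rank_permutationMatrix_embedPerm t
  have hcq : (matrix (coxeterElement d q) - 1).rank ≤ q :=
    (Matrix.rank_le_card_width _).trans_eq (Fintype.card_fin q)
  have h1 := Nat.mul_le_mul_left d h
  have h2 := Nat.mul_le_mul_left d hcq
  rw [mul_add, mul_add] at h1
  -- If the claim fails, `d * q` is at most the sum of the ranks on `ℂ ^ n`, which is at most `d *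
  -- rank (c - 1) ≤ d * q`. All inequalities are equalities, so each factor has product of entries
  -- `1`, against `ζ_d` for `c`. This leaves `d = 1`, where the all-ones vector is fixed by `c` and
  -- the rank is less than `q`.
  obtain ⟨y, hy, hy0⟩ := hv' (by omega)
  obtain ⟨y', hy', hy0'⟩ := hu' (by omega)
  obtain ⟨y'', hy'', hy0''⟩ := ht' (by omega)
  have h3 : d * q ≤ d * (matrix (coxeterElement d q) - 1).rank := by omega
  have h4 := Nat.le_of_mul_le_mul_left h3 (NeZero.pos d)
  have h5 : zetaRoot d = 1 := by
    rw [← colSumProd_coxeterElement (q := q), ← hc, colSumProd_matrix_mul, colSumProd_matrix_mul,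
      colSumProd_eq_one hy hy0, colSumProd_eq_one hy' hy0', colSumProd_eq_one hy'' hy0'']
    norm_num
  have h6 : d = 1 := by
    have := (zetaRoot_primitive d).dvd_of_pow_eq_one 1 (by rw [h5, one_pow])
    exact Nat.dvd_one.1 this
  subst h6
  exact absurd h4 (not_le.2 (rank_coxeterElement_lt q))

end

/-! ### The order on the interval below the Coxeter element -/

section

theorem IsArcShift.sum_Ico {n : ℕ} {M : Type*} [AddCommMonoid M] {v : Equiv.Perm (Fin n)}
    (hv : IsArcShift v) {a b : Fin n} (hab : v.SameCycle a b) (f : Fin n → M) :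
    ∑ k ∈ Finset.Ico a b, f (v k) = ∑ k ∈ Finset.Ioc a b, f k := by
  rw [← Finset.sum_image (g := v) (f := f) v.injective.injOn]
  congr 1
  refine Finset.eq_of_subset_of_card_le (fun l hl => ?_) ?_
  · obtain ⟨k, hk, rfl⟩ := Finset.mem_image.1 hl
    rw [Finset.mem_Ico] at hk
    exact Finset.mem_Ioc.2 (hv a k b hab hk.1 hk.2)
  · rw [Finset.card_image_of_injective _ v.injective, Fin.card_Ioc, Fin.card_Ico]

theorem sum_Ioc_sub_sum_Ico {n : ℕ} {M : Type*} [AddCommGroup M] {a b : Fin n} (hab : a ≤ b)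
    (f : Fin n → M) :
    ∑ k ∈ Finset.Ioc a b, f k - ∑ k ∈ Finset.Ico a b, f k = f b - f a := by
  have h1 := Finset.sum_insert (f := f) (Finset.left_notMem_Ioc (a := a) (b := b))
  have h2 := Finset.sum_insert (f := f) (Finset.right_notMem_Ico (a := a) (b := b))
  rw [Finset.Ioc_insert_left hab] at h1
  rw [Finset.Ico_insert_right hab, h1] at h2
  rw [sub_eq_sub_iff_add_eq_add, add_comm, h2, add_comm]

theorem isArcShift_cyclic {n : ℕ} {c : Equiv.Perm (Fin n)}
    (hc : ∀ k l : Fin n, (k : ℕ) + 1 = l → c k = l) : IsArcShift c := by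
  intro a b a' _ hab hba'
  rw [hc b ⟨b + 1, by omega⟩ rfl]
  simp only [Fin.lt_def, Fin.le_def] at *
  omega

open monomialGroup

variable {d q : ℕ} [NeZero d]

/-- On each single letter `v` acts as some power of `w`, with an exponent depending on the letter.
So `v` and that power give the same relation between two coordinates of `x`. -/
theorem mulVec_eq_of_sameCycle_imp {v w : monomialGroup d q}
    (h : ∀ k l, (embedPerm d q v).SameCycle k l → (embedPerm d q w).SameCycle k l)
    {x : Fin q → ℂ} (hx : (matrix w).mulVec x = x) : (matrix v).mulVec x = x := by
  funext i
  obtain ⟨l, hl⟩ := exists_letter_eq (d := d) i (one_pow d)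
  obtain ⟨k, rfl⟩ := (embedPerm d q v).surjective l
  obtain ⟨m, hm⟩ := (h k _
    (Equiv.Perm.sameCycle_apply_right.2 (Equiv.Perm.SameCycle.refl _ k))).exists_nat_pow_eq
  rw [← map_pow] at hm
  obtain ⟨j, a, ha, hk⟩ := exists_letter_single k
  have hxm : (matrix (w ^ m)).mulVec x = x := by
    clear hm
    induction m with
    | zero => rw [pow_zero, matrix_one, Matrix.one_mulVec]
    | succ m ih => rw [pow_succ, matrix_mul, ← Matrix.mulVec_mulVec, hx, ih]
  have h1 := matrix_mulVec_apply v one_ne_zero (by rw [← hk, matrix_mulVec_letter, hl]) x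
  have h2 := matrix_mulVec_apply (w ^ m) one_ne_zero
    (by rw [← hk, matrix_mulVec_letter, hm, hl]) x
  rw [hxm] at h2
  exact mul_left_cancel₀ (ne_zero_of_pow_eq_one ha) (h1.trans h2.symm)

/-- If the images of `v` and `w` are arc shifts, and the cycles of `v` refine those of `w`, then
`v ≼ w`. -/
theorem absoluteLE_of_isArcShift {v w : monomialGroup d q} (hv : IsArcShift (embedPerm d q v))
    (hw : IsArcShift (embedPerm d q w))
    (h : ∀ k l, (embedPerm d q v).SameCycle k l → (embedPerm d q w).SameCycle k l) :
    AbsoluteLE (monomialGroup d q) v w := by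
  rw [absoluteLE_iff]
  refine Matrix.rank_add_le_of_forall_exists (by rw [← matrix_mul, mul_inv_cancel_left])
    (matrix_mulVec_injective v) (fun x => mulVec_eq_of_sameCycle_imp h) fun i => ?_
  have hsum : ∀ g : monomialGroup d q, IsArcShift (embedPerm d q g) → ∀ a b,
      (embedPerm d q g).SameCycle a b →
      (matrix g).mulVec (∑ k ∈ Finset.Ico a b, letter d q k)
        = ∑ k ∈ Finset.Ioc a b, letter d q k := by
    intro g hg a b hab
    rw [Matrix.mulVec_sum, ← hg.sum_Ico hab]
    exact Finset.sum_congr rfl fun k _ => matrix_mulVec_letter g k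
  -- With `a` the number of `e_i` and `b` that of its image, the witness is the sum of the letters
  -- in `[a, b)`. Both `v` and `w` shift it to the sum over `(a, b]`, and the difference is the
  -- letter `b` minus the letter `a`. If `b ≤ a`, the roles are exchanged and the sign changes.
  obtain ⟨a, ha⟩ := exists_letter_eq (d := d) i (one_pow d)
  rw [← ha, matrix_mulVec_letter]
  set b := embedPerm d q v a with hb
  have hab : (embedPerm d q v).SameCycle a b := by simp [hb, Equiv.Perm.SameCycle.refl]
  rcases le_total a b with hle | hle
  · refine ⟨∑ k ∈ Finset.Ico a b, letter d q k, ?_, ?_⟩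
    · rw [hsum v hv a b hab, hsum w hw a b (h _ _ hab)]
    · rw [hsum w hw a b (h _ _ hab), sum_Ioc_sub_sum_Ico hle]
  · refine ⟨-∑ k ∈ Finset.Ico b a, letter d q k, ?_, ?_⟩
    · rw [Matrix.mulVec_neg, Matrix.mulVec_neg, hsum v hv b a hab.symm,
        hsum w hw b a (h _ _ hab.symm)]
    · rw [Matrix.mulVec_neg, hsum w hw b a (h _ _ hab.symm), ← neg_sub_neg, neg_neg, neg_neg,
        ← neg_sub, sum_Ioc_sub_sum_Ico hle, neg_sub]

theorem isArcShift_embedPerm [NeZero q] {v : monomialGroup d q}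
    (hv : AbsoluteLE (monomialGroup d q) v (coxeterElement d q)) :
    IsArcShift (embedPerm d q v) := by
  rw [absoluteLE_iff] at hv
  have h1 := rank_permutationMatrix_add_lt (v := v) (u := v⁻¹ * coxeterElement d q) (t := 1)
    (by simp) (by simpa [matrix_one] using hv)
  refine isArcShift_of_rank_add_lt embedPerm_coxeterElement
    (u := embedPerm d q (v⁻¹ * coxeterElement d q)) ?_ ?_
  · rw [← map_mul, mul_inv_cancel_left]
  · omega

theorem sameCycle_of_absoluteLE [NeZero q] {v w : monomialGroup d q}
    (hvw : AbsoluteLE (monomialGroup d q) v w)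
    (hw : AbsoluteLE (monomialGroup d q) w (coxeterElement d q)) {k l : Fin (d * q)}
    (h : (embedPerm d q v).SameCycle k l) : (embedPerm d q w).SameCycle k l := by
  rw [absoluteLE_iff] at hvw hw
  have h1 := rank_permutationMatrix_add_lt (v := v) (u := v⁻¹ * w)
    (t := w⁻¹ * coxeterElement d q) (by simp) (by omega)
  have h2 := Matrix.rank_add_finrank_fixedSpace
    (permutationMatrix (embedPerm d q (coxeterElement d q)))
  -- The long cycle has rank at least `n - 1` on `ℂ ^ n`, and the three factors have total rank at
  -- most `n - 1`. Subadditivity for `w * (w⁻¹ * c)` then forces the ranks of `v` and `v⁻¹ * w` to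
  -- add up to at most that of `w`.
  have h3 := finrank_fixedSpace_cyclic_le (embedPerm_coxeterElement (d := d) (q := q))
  have h4 := Matrix.rank_mul_sub_one_le (permutationMatrix (embedPerm d q w))
    (permutationMatrix (embedPerm d q (w⁻¹ * coxeterElement d q)))
  rw [← permutationMatrix_mul, ← map_mul, mul_inv_cancel_left] at h4
  rw [Fintype.card_fin] at h2
  have h5 : embedPerm d q v * embedPerm d q (v⁻¹ * w) = embedPerm d q w := by
    rw [← map_mul, mul_inv_cancel_left]
  rw [← h5]
  refine sameCycle_of_rank_add_le ?_ h
  rw [h5]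
  omega

end

/-! ### Noncrossing partitions -/

section

variable {n : ℕ}

/-- No two blocks of the partition `P` of `{0, …, n - 1}` cross. -/
def NoBlocksCross (P : Setoid (Fin n)) : Prop :=
  ∀ a b a' b' : Fin n, a < b → b < a' → a' < b' → P a a' → P b b' → P a b

/-! ### Chords and convex hulls of vertices on the unit circle -/

theorem polygonVertex_eq (k : Fin n) :
    polygonVertex n k = Complex.exp ((2 * (Real.pi * k / n) : ℝ) * Complex.I) := by
  rw [polygonVertex, zetaRoot, ← Complex.exp_nat_mul]
  congr 1
  push_cast
  ring

theorem polygonVertex_re (k : Fin n) :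
    (polygonVertex n k).re = Real.cos (2 * (Real.pi * k / n)) := by
  rw [polygonVertex_eq, Complex.exp_ofReal_mul_I_re]

theorem polygonVertex_im (k : Fin n) :
    (polygonVertex n k).im = Real.sin (2 * (Real.pi * k / n)) := by
  rw [polygonVertex_eq, Complex.exp_ofReal_mul_I_im]

theorem polygonVertex_injective : Function.Injective (polygonVertex n) := by
  rintro ⟨k, hk⟩ ⟨l, hl⟩ h
  have : NeZero n := ⟨by omega⟩
  exact Fin.ext ((zetaRoot_primitive n).pow_inj hk hl h)

theorem sin_pi_mul_div_nonneg {x : ℝ} (h0 : 0 ≤ x) (hn : x ≤ n) :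
    0 ≤ Real.sin (Real.pi * x / n) := by
  refine Real.sin_nonneg_of_nonneg_of_le_pi (by positivity) ?_
  rw [mul_div_assoc]
  exact mul_le_of_le_one_right Real.pi_pos.le (div_le_one_of_le₀ hn (Nat.cast_nonneg n))

theorem sin_pi_mul_div_pos {x : ℝ} (h0 : 0 < x) (hn : x < n) :
    0 < Real.sin (Real.pi * x / n) := by
  have hn0 : (0 : ℝ) < n := h0.trans hn
  refine Real.sin_pos_of_pos_of_lt_pi (by positivity) ?_
  rw [mul_div_assoc]
  exact mul_lt_of_lt_one_right Real.pi_pos ((div_lt_one hn0).2 hn)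

/-- The equation of the line through two points of the unit circle. -/
theorem chord_equation (x α β : ℝ) :
    Real.cos (2 * x) * Real.cos (α + β) + Real.sin (2 * x) * Real.sin (α + β) - Real.cos (β - α)
      = 2 * Real.sin (x - α) * Real.sin (β - x) := by
  rw [← Real.cos_sub, Real.cos_sub_cos, ← neg_sub x β, Real.sin_neg]
  ring_nf

/-- This computes twice the area of an inscribed triangle as a product of sines of half arcs, which
makes positivity visible for vertices in cyclic order. -/
theorem cross_eq (x y z : ℝ) :
    (Real.cos (2 * y) - Real.cos (2 * x)) * (Real.sin (2 * z) - Real.sin (2 * x))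
      - (Real.sin (2 * y) - Real.sin (2 * x)) * (Real.cos (2 * z) - Real.cos (2 * x))
      = 4 * Real.sin (y - x) * Real.sin (z - y) * Real.sin (z - x) := by
  have h1 : (Real.cos (2 * y) - Real.cos (2 * x)) * (Real.sin (2 * z) - Real.sin (2 * x))
      - (Real.sin (2 * y) - Real.sin (2 * x)) * (Real.cos (2 * z) - Real.cos (2 * x))
      = Real.sin (2 * (z - y)) + Real.sin (2 * (y - x))
        - Real.sin (2 * (y - x) + 2 * (z - y)) := by
    rw [show 2 * (y - x) + 2 * (z - y) = 2 * z - 2 * x by ring, mul_sub 2 z, mul_sub 2 y,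
      Real.sin_sub, Real.sin_sub, Real.sin_sub]
    ring
  rw [h1, show z - x = (y - x) + (z - y) by ring, Real.sin_add, Real.sin_add, Real.sin_two_mul,
    Real.sin_two_mul, Real.cos_two_mul', Real.cos_two_mul', Real.cos_sq', Real.cos_sq']
  ring

/-- Twice the signed area of a triangle in the plane. -/
def cross (p q r : ℂ) : ℝ := (q.re - p.re) * (r.im - p.im) - (q.im - p.im) * (r.re - p.re)

theorem cross_polygonVertex_pos {a b c : Fin n} (hab : a < b) (hbc : b < c) :
    0 < cross (polygonVertex n a) (polygonVertex n b) (polygonVertex n c) := by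
  have key : ∀ k l : Fin n, k < l →
      0 < Real.sin (Real.pi * l / n - Real.pi * k / n) := by
    intro k l hkl
    rw [← sub_div, ← mul_sub]
    have h1 : (k : ℝ) < l := by exact_mod_cast hkl
    have h2 : (l : ℝ) < n := by exact_mod_cast l.2
    have h3 : (0 : ℝ) ≤ k := Nat.cast_nonneg _
    exact sin_pi_mul_div_pos (by linarith) (by linarith)
  rw [cross]
  simp only [polygonVertex_re, polygonVertex_im]
  rw [cross_eq]
  have := key a b hab
  have := key b c hbc
  have := key a c (hab.trans hbc)
  positivity

/-- Two chords whose end points alternate on the circle intersect. -/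
theorem segment_inter_segment_nonempty {p q r s : ℂ} (h1 : 0 < cross q r s) (h2 : 0 < cross p r s)
    (h3 : 0 < cross p q s) (h4 : 0 < cross p q r) : (segment ℝ p r ∩ segment ℝ q s).Nonempty := by
  have hsum : cross q r s + cross p q s = cross p r s + cross p q r := by
    simp only [cross]; ring
  have hpos : 0 < cross q r s + cross p q s := add_pos h1 h3
  -- The weights on each diagonal are the areas of the triangles cut off by the other one. Their
  -- totals agree by `hsum`: both diagonals cut the same quadrilateral.
  refine ⟨(cross q r s / (cross q r s + cross p q s)) • p
      + (cross p q s / (cross q r s + cross p q s)) • r,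
    ⟨_, _, by positivity, by positivity, ?_, rfl⟩,
    ⟨cross p r s / (cross q r s + cross p q s), cross p q r / (cross q r s + cross p q s),
      by positivity, by positivity, ?_, ?_⟩⟩
  · field_simp
  · rw [← add_div, ← hsum, div_self hpos.ne']
  · apply Complex.ext
    · simp only [Complex.add_re, Complex.real_smul, Complex.mul_re, Complex.ofReal_re,
        Complex.ofReal_im, zero_mul, sub_zero]
      field_simp
      simp only [cross]
      ring
    · simp only [Complex.add_im, Complex.real_smul, Complex.mul_im, Complex.ofReal_re,
        Complex.ofReal_im, zero_mul, add_zero]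
      field_simp
      simp only [cross]
      ring

theorem mem_polygonParts (P : Setoid (Fin n)) (a : Fin n) :
    polygonVertex n '' {x | P x a} ∈ polygonParts P := ⟨_, Setoid.mem_classes P a, rfl⟩

theorem polygonVertex_mem_image {P : Setoid (Fin n)} {a b : Fin n} :
    polygonVertex n b ∈ polygonVertex n '' {x | P x a} ↔ P b a :=
  polygonVertex_injective.mem_set_image

theorem IsNoncrossing.noBlocksCross {P : Setoid (Fin n)} (hP : IsNoncrossing P) :
    NoBlocksCross P := by
  intro a b a' b' hab hba' ha'b' haa' hbb'
  by_contra hcon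
  have hne : polygonVertex n '' {x | P x a} ≠ polygonVertex n '' {x | P x b} := fun h => by
    have h1 : polygonVertex n a ∈ polygonVertex n '' {x | P x a} :=
      polygonVertex_mem_image.2 (P.refl a)
    rw [h] at h1
    exact hcon (polygonVertex_mem_image.1 h1)
  have hdisj := hP (mem_polygonParts P a) (mem_polygonParts P b) hne
  obtain ⟨z, hz1, hz2⟩ := segment_inter_segment_nonempty
    (cross_polygonVertex_pos hba' ha'b') (cross_polygonVertex_pos (hab.trans hba') ha'b')
    (cross_polygonVertex_pos hab (hba'.trans ha'b')) (cross_polygonVertex_pos hab hba')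
  refine Set.disjoint_iff.1 hdisj (show z ∈ _ from ⟨?_, ?_⟩)
  · exact segment_subset_convexHull (polygonVertex_mem_image.2 (P.refl a))
      (polygonVertex_mem_image.2 (P.symm haa')) hz1
  · exact segment_subset_convexHull (polygonVertex_mem_image.2 (P.refl b))
      (polygonVertex_mem_image.2 (P.symm hbb')) hz2

/-- A set of vertices in an open arc and a set of vertices in the complementary closed arc have
disjoint convex hulls. -/
theorem disjoint_convexHull_of_arc {A B : Set (Fin n)} {α β : ℕ} (hβ : β ≤ α + n)
    (hαβ : α < β) (hB : ∀ b ∈ B, α < b ∧ (b : ℕ) < β)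
    (hA : ∀ a ∈ A, ((a : ℕ) ≤ α ∧ β ≤ a + n) ∨ β ≤ a) :
    Disjoint (convexHull ℝ (polygonVertex n '' A)) (convexHull ℝ (polygonVertex n '' B)) := by
  -- The line `f = η` passes through the points of the circle at positions `α` and `β`. By
  -- `chord_equation` the sign of `f - η` at a vertex is that of a product of two sines, positive
  -- exactly on the side of the open arc containing `B`. The index `β` may exceed `n`, for arcs that
  -- wrap around.
  set μ : ℝ := Real.pi * α / n + Real.pi * β / n
  set η : ℝ := Real.cos (Real.pi * β / n - Real.pi * α / n)
  let f : ℂ → ℝ := fun z => z.re * Real.cos μ + z.im * Real.sin μ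
  have hf : IsLinearMap ℝ f := ⟨fun z w => by simp [f]; ring, fun t z => by simp [f]; ring⟩
  have hfv : ∀ k : Fin n, f (polygonVertex n k) - η =
      2 * Real.sin (Real.pi * (k - α) / n) * Real.sin (Real.pi * (β - k) / n) := by
    intro k
    simp only [f, polygonVertex_re, polygonVertex_im, η, μ]
    rw [chord_equation, mul_sub, mul_sub, sub_div, sub_div]
  have hβ' : (β : ℝ) ≤ α + n := by exact_mod_cast hβ
  have hαβ' : (α : ℝ) < β := by exact_mod_cast hαβ
  have hα0 : (0 : ℝ) ≤ α := Nat.cast_nonneg _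
  have hA' : convexHull ℝ (polygonVertex n '' A) ⊆ {z | f z ≤ η} := by
    refine convexHull_min ?_ (convex_halfSpace_le hf _)
    rintro _ ⟨a, ha, rfl⟩
    change f _ ≤ η
    rw [← sub_nonpos, hfv]
    have han : (a : ℝ) ≤ n := by exact_mod_cast a.2.le
    have ha0 : (0 : ℝ) ≤ (a : ℕ) := Nat.cast_nonneg _
    rcases hA a ha with ⟨h1, h2⟩ | h1
    · have h1' : (a : ℝ) ≤ α := by exact_mod_cast h1
      have h2' : (β : ℝ) ≤ a + n := by exact_mod_cast h2
      have h3 := sin_pi_mul_div_nonneg (n := n) (x := α - a) (by linarith) (by linarith)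
      have h4 := sin_pi_mul_div_nonneg (n := n) (x := β - a) (by linarith) (by linarith)
      rw [← neg_sub (α : ℝ), mul_neg, neg_div, Real.sin_neg]
      nlinarith [mul_nonneg h3 h4]
    · have h1' : (β : ℝ) ≤ a := by exact_mod_cast h1
      have h3 := sin_pi_mul_div_nonneg (n := n) (x := a - α) (by linarith) (by linarith)
      have h4 := sin_pi_mul_div_nonneg (n := n) (x := a - β) (by linarith) (by linarith)
      rw [← neg_sub (a : ℝ) β, mul_neg, neg_div, Real.sin_neg]
      nlinarith [mul_nonneg h3 h4]
  have hB' : convexHull ℝ (polygonVertex n '' B) ⊆ {z | η < f z} := by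
    refine convexHull_min ?_ (convex_halfSpace_gt hf _)
    rintro _ ⟨b, hb, rfl⟩
    change η < f _
    rw [← sub_pos, hfv]
    obtain ⟨h1, h2⟩ := hB b hb
    have h1' : (α : ℝ) < b := by exact_mod_cast h1
    have h2' : (b : ℝ) < β := by exact_mod_cast h2
    have h3 := sin_pi_mul_div_pos (n := n) (x := b - α) (by linarith) (by linarith)
    have h4 := sin_pi_mul_div_pos (n := n) (x := β - b) (by linarith) (by linarith)
    positivity
  refine Set.disjoint_left.2 fun z hz1 hz2 => ?_
  exact (lt_of_lt_of_le (show η < f z from hB' hz2) (hA' hz1)).false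

theorem disjoint_convexHull_of_lt {P : Setoid (Fin n)} (hP : NoBlocksCross P) {m b : Fin n}
    (hmb : m < b) (hm : ∀ x, P x m → m ≤ x) (hb : ∀ x, P x b → b ≤ x) (hne : ¬ P m b) :
    Disjoint (convexHull ℝ (polygonVertex n '' {x | P x m}))
      (convexHull ℝ (polygonVertex n '' {x | P x b})) := by
  classical
  -- The separating chord joins the last point `a` of the block of `m` before `b` to the first one
  -- after `b`. Noncrossing confines the block of `b` to the gap between them.
  obtain ⟨a, ha, hamax⟩ := (Finset.univ.filter fun x => P x m ∧ x < b).exists_max_image id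
    ⟨m, by simp [hmb]⟩
  simp only [Finset.mem_filter, Finset.mem_univ, true_and, id] at ha hamax
  have hnab : ∀ x y, P x m → P y b → x ≠ y := fun x y hx hy hxy => by
    subst hxy
    exact hne (P.trans (P.symm hx) hy)
  by_cases hex : ∃ x, P x m ∧ b < x
  · obtain ⟨a', ha', ha'min⟩ := (Finset.univ.filter fun x => P x m ∧ b < x).exists_min_image id
      (by obtain ⟨x, hx⟩ := hex; exact ⟨x, by simpa using hx⟩)
    simp only [Finset.mem_filter, Finset.mem_univ, true_and, id] at ha' ha'min
    refine disjoint_convexHull_of_arc (α := a) (β := a') (by omega)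
      (Fin.lt_def.1 (ha.2.trans ha'.2)) (fun x hx => ⟨?_, ?_⟩) fun x hx => ?_
    · exact Fin.lt_def.1 (ha.2.trans_le (hb x hx))
    · by_contra hcon
      have h1 : a' < x := lt_of_le_of_ne (not_lt.1 hcon) (hnab _ _ ha'.1 hx)
      have h2 := hP a b a' x ha.2 ha'.2 h1 (P.trans ha.1 (P.symm ha'.1)) (P.symm hx)
      exact hnab a a ha.1 h2 rfl
    · rcases lt_or_ge x b with h | h
      · have := hamax x ⟨hx, h⟩
        exact Or.inl ⟨this, by omega⟩
      · have := ha'min x ⟨hx, lt_of_le_of_ne h (hnab x b hx (P.refl b)).symm⟩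
        exact Or.inr this
  · push Not at hex
    -- The block of `m` has no point after `b`, so the gap ends at `m` on the next turn, that is at
    -- `m + n`.
    refine disjoint_convexHull_of_arc (α := a) (β := m + n) ?_ (by omega)
      (fun x hx => ⟨?_, by omega⟩) fun x hx => Or.inl ⟨?_, ?_⟩
    · have := Fin.le_def.1 (hm a ha.1)
      omega
    · exact Fin.lt_def.1 (ha.2.trans_le (hb x hx))
    · exact hamax x ⟨hx, lt_of_le_of_ne (hex x hx) (hnab x b hx (P.refl b))⟩
    · have := Fin.le_def.1 (hm x hx)
      omega

theorem exists_min_representative (P : Setoid (Fin n)) (a : Fin n) :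
    ∃ m, P m a ∧ (∀ x, P x m → m ≤ x) ∧ {x | P x a} = {x | P x m} := by
  classical
  obtain ⟨m, hm, hmin⟩ := (Finset.univ.filter fun x => P x a).exists_min_image id
    ⟨a, by simp⟩
  simp only [Finset.mem_filter, Finset.mem_univ, true_and, id] at hm hmin
  exact ⟨m, hm, fun x hx => hmin x (P.trans hx hm), Set.ext fun x =>
    ⟨fun h => P.trans h (P.symm hm), fun h => P.trans h hm⟩⟩

theorem NoBlocksCross.isNoncrossing {P : Setoid (Fin n)} (hP : NoBlocksCross P) :
    IsNoncrossing P := by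
  rintro _ ⟨_, ⟨a, rfl⟩, rfl⟩ _ ⟨_, ⟨b, rfl⟩, rfl⟩ hne
  obtain ⟨m, -, hm, hma⟩ := exists_min_representative P a
  obtain ⟨k, -, hk, hkb⟩ := exists_min_representative P b
  simp only [hma, hkb] at hne ⊢
  have hmk : ¬ P m k := fun h => hne (congrArg _ (Set.ext fun x =>
    ⟨fun hx => P.trans hx h, fun hx => P.trans hx (P.symm h)⟩))
  rcases lt_trichotomy m k with h | rfl | h
  · exact disjoint_convexHull_of_lt hP h hm hk hmk
  · exact absurd (P.refl m) hmk
  · exact (disjoint_convexHull_of_lt hP h hk hm fun h' => hmk (P.symm h')).symm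

/-- The orbit of `b` is trapped: each step from inside `(a, a')` lands in `(a, a']`, and landing on
`a'` would put `b` in the cycle of `a`. So it never reaches `b'`. -/
theorem IsArcShift.noBlocksCross {v : Equiv.Perm (Fin n)} (hv : IsArcShift v) :
    NoBlocksCross (Equiv.Perm.SameCycle.setoid v) := by
  intro a b a' b' hab hba' ha'b' haa' hbb'
  change v.SameCycle a b
  by_contra hcon
  obtain ⟨m, rfl⟩ := Equiv.Perm.SameCycle.exists_nat_pow_eq hbb'
  clear hbb'
  have key : ∀ m : ℕ, a < (v ^ m) b ∧ (v ^ m) b < a' := by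
    intro m
    induction m with
    | zero => exact ⟨hab, hba'⟩
    | succ m ih =>
      obtain ⟨h1, h2⟩ := hv a _ a' haa' ih.1.le ih.2
      rw [pow_succ', Equiv.Perm.mul_apply]
      refine ⟨h1, lt_of_le_of_ne h2 fun h => hcon ?_⟩
      refine Equiv.Perm.SameCycle.trans haa' ?_
      rw [← h, Equiv.Perm.sameCycle_apply_left, Equiv.Perm.sameCycle_pow_left]
  exact absurd (key m).2 (not_lt.2 ha'b'.le)

end

/-! ### The first return permutation -/

section

variable {n : ℕ}

theorem exists_pow_rel (c : Equiv.Perm (Fin n)) (P : Setoid (Fin n)) (a : Fin n) :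
    ∃ k, 0 < k ∧ P ((c ^ k) a) a :=
  ⟨orderOf c, orderOf_pos c, by rw [pow_orderOf_eq_one]; exact P.refl a⟩

/-- The smallest positive number of applications of `c` that lead from `a` back to its block. -/
noncomputable def returnTime (c : Equiv.Perm (Fin n)) (P : Setoid (Fin n)) (a : Fin n) : ℕ :=
  sInf {k | 0 < k ∧ P ((c ^ k) a) a}

theorem returnTime_spec (c : Equiv.Perm (Fin n)) (P : Setoid (Fin n)) (a : Fin n) :
    0 < returnTime c P a ∧ P ((c ^ returnTime c P a) a) a :=
  Nat.sInf_mem (exists_pow_rel c P a)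

theorem returnTime_le {c : Equiv.Perm (Fin n)} {P : Setoid (Fin n)} {a : Fin n} {k : ℕ}
    (hk : 0 < k) (h : P ((c ^ k) a) a) : returnTime c P a ≤ k :=
  Nat.sInf_le ⟨hk, h⟩

/-- If `b` needed more steps than `a` to reach the common point, its path would run through `a`, a
point of its own block, before its first return. -/
theorem pow_returnTime_le_of_eq {c : Equiv.Perm (Fin n)} {P : Setoid (Fin n)} {a b : Fin n}
    (h : (c ^ returnTime c P a) a = (c ^ returnTime c P b) b) :
    returnTime c P b ≤ returnTime c P a := by
  by_contra! hlt
  obtain ⟨m, hm⟩ := Nat.exists_eq_add_of_lt hlt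
  have h1 : a = (c ^ (m + 1)) b := by
    apply (c ^ returnTime c P a).injective
    rw [h, ← Equiv.Perm.mul_apply, ← pow_add, ← add_assoc, ← hm]
  have h2 : P a b := by
    refine P.trans (P.symm (returnTime_spec c P a).2) ?_
    rw [h]
    exact (returnTime_spec c P b).2
  have h3 := returnTime_le (c := c) (P := P) (a := b) (k := m + 1) (Nat.succ_pos m) (h1 ▸ h2)
  have := (returnTime_spec c P a).1
  omega

theorem pow_returnTime_injective (c : Equiv.Perm (Fin n)) (P : Setoid (Fin n)) :
    Function.Injective fun a => (c ^ returnTime c P a) a := by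
  intro a b h
  have := le_antisymm (pow_returnTime_le_of_eq h) (pow_returnTime_le_of_eq h.symm)
  dsimp only at h
  rw [this] at h
  exact (c ^ _).injective h

/-- The permutation that maps every point to the next point of its block along the orbits of
`c`. -/
noncomputable def firstReturn (c : Equiv.Perm (Fin n)) (P : Setoid (Fin n)) :
    Equiv.Perm (Fin n) :=
  Equiv.ofBijective _ (Finite.injective_iff_bijective.1 (pow_returnTime_injective c P))

theorem firstReturn_apply (c : Equiv.Perm (Fin n)) (P : Setoid (Fin n)) (a : Fin n) :
    firstReturn c P a = (c ^ returnTime c P a) a := rfl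

theorem firstReturn_rel (c : Equiv.Perm (Fin n)) (P : Setoid (Fin n)) (a : Fin n) :
    P (firstReturn c P a) a := (returnTime_spec c P a).2

/-- A symmetry of `c` and `P` preserves return times. This equivariance places the first return map
in the image of `G(d,1,q)`. -/
theorem firstReturn_apply_of_commute {c ρ : Equiv.Perm (Fin n)} {P : Setoid (Fin n)}
    (hρ : Commute ρ c) (hP : ∀ a b, P (ρ a) (ρ b) ↔ P a b) (a : Fin n) :
    firstReturn c P (ρ a) = ρ (firstReturn c P a) := by
  have h : ∀ k, (c ^ k) (ρ a) = ρ ((c ^ k) a) := fun k => by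
    rw [← Equiv.Perm.mul_apply, ← Equiv.Perm.mul_apply, (hρ.pow_right k).eq]
  simp only [firstReturn_apply, returnTime, h, hP]

variable {c : Equiv.Perm (Fin n)} (hc : ∀ k l : Fin n, (k : ℕ) + 1 = l → c k = l)

include hc in
theorem cyclic_pow_apply (k : ℕ) (a : Fin n) (h : a + k < n) :
    (((c ^ k) a : Fin n) : ℕ) = a + k := by
  induction k with
  | zero => rfl
  | succ k ih =>
    rw [pow_succ', Equiv.Perm.mul_apply, hc _ ⟨a + k + 1, by omega⟩ (by rw [ih (by omega)])]
    rfl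

include hc in
theorem firstReturn_mem_Ioc {P : Setoid (Fin n)} {a b : Fin n} (hab : a < b) (h : P a b) :
    a < firstReturn c P a ∧ firstReturn c P a ≤ b := by
  have hlt := Fin.lt_def.1 hab
  have h1 : (c ^ ((b : ℕ) - a)) a = b := Fin.ext (by rw [cyclic_pow_apply hc _ _ (by omega)]; omega)
  have h2 := returnTime_le (c := c) (P := P) (a := a) (k := b - a) (by omega)
    (by rw [h1]; exact P.symm h)
  have h3 := (returnTime_spec c P a).1
  rw [Fin.lt_def, Fin.le_def, firstReturn_apply, cyclic_pow_apply hc _ _ (by omega)]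
  omega

include hc in
theorem sameCycle_firstReturn_iff {P : Setoid (Fin n)} {a b : Fin n} :
    (firstReturn c P).SameCycle a b ↔ P a b := by
  constructor
  · intro h
    obtain ⟨k, rfl⟩ := h.exists_nat_pow_eq
    clear h
    induction k with
    | zero => exact P.refl a
    | succ k ih =>
      rw [pow_succ', Equiv.Perm.mul_apply]
      exact P.trans ih (P.symm (firstReturn_rel c P _))
  -- Induction on a bound for the distance: the first return moves `a` forward inside its block
  -- without passing `b`.
  · have key : ∀ (m : ℕ) (a b : Fin n), (b : ℕ) ≤ a + m → a ≤ b → P a b →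
        (firstReturn c P).SameCycle a b := by
      intro m
      induction m with
      | zero =>
        intro a b h1 h2 _
        rw [Fin.ext (le_antisymm (Fin.le_def.1 h2) h1)]
      | succ m ih =>
        intro a b h1 h2 h3
        rcases h2.eq_or_lt with rfl | hlt
        · exact Equiv.Perm.SameCycle.refl _ _
        obtain ⟨h4, h5⟩ := firstReturn_mem_Ioc hc hlt h3
        rw [← Equiv.Perm.sameCycle_apply_left]
        refine ih _ _ ?_ h5 (P.trans (firstReturn_rel c P a) h3)
        have := Fin.lt_def.1 h4
        omega
    intro h
    rcases le_total a b with hab | hab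
    · exact key b a b (by omega) hab h
    · exact (key a b a (by omega) hab (P.symm h)).symm

include hc in
theorem isArcShift_firstReturn {P : Setoid (Fin n)} (hP : NoBlocksCross P) :
    IsArcShift (firstReturn c P) := by
  intro a b a' haa' hab hba'
  rw [sameCycle_firstReturn_iff hc] at haa'
  by_cases h : P a b
  · obtain ⟨h1, h2⟩ := firstReturn_mem_Ioc hc hba' (P.trans (P.symm h) haa')
    exact ⟨hab.trans_lt h1, h2⟩
  · have hab' : a < b := lt_of_le_of_ne hab fun h' => h (h' ▸ P.refl a)
    have hr := firstReturn_rel c P b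
    set r := firstReturn c P b
    -- An image of `b` outside `(a, a']` would lie in the block of `a` if it equals `a`, and
    -- otherwise make the blocks of `a` and `b` cross: `r < a < b < a'` or `a < b < a' < r`.
    constructor
    · by_contra! hcon
      rcases hcon.eq_or_lt with h' | h'
      · exact h (h' ▸ hr)
      · exact h (P.trans (P.symm (hP r a b a' h' hab' hba' hr haa')) hr)
    · by_contra! hcon
      exact h (hP a b a' r hab' hba' hcon haa' (P.symm hr))

end

/-! ### Invariance under roots of unity -/

theorem IsMuInvariant.rel {d n : ℕ} {P : Setoid (Fin n)} (hP : IsMuInvariant d P) {x : ℂ}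
    (hx : x ^ d = 1) {k l k' l' : Fin n} (hk : polygonVertex n k' = x * polygonVertex n k)
    (hl : polygonVertex n l' = x * polygonVertex n l) (h : P k l) : P k' l' := by
  obtain ⟨_, ⟨e, rfl⟩, he⟩ := hP x hx _ (mem_polygonParts P l)
  dsimp only at he
  have h1 : P k' e := by
    rw [← polygonVertex_mem_image (P := P), he, hk, ← smul_eq_mul]
    exact Set.smul_mem_smul_set (polygonVertex_mem_image.2 h)
  have h2 : P l' e := by
    rw [← polygonVertex_mem_image (P := P), he, hl, ← smul_eq_mul]
    exact Set.smul_mem_smul_set (polygonVertex_mem_image.2 (P.refl l))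
  exact P.trans h1 (P.symm h2)

section

open monomialGroup

variable {d q : ℕ} [NeZero d]

theorem exists_scalar {x : ℂ} (hx : x ^ d = 1) :
    ∃ s : monomialGroup d q, ∀ y : Fin q → ℂ, (matrix s).mulVec y = x • y := by
  obtain ⟨s, hs⟩ := exists_matrix_eq (d := d) (q := q) 1 (a := fun _ => x) fun _ => hx
  refine ⟨s, fun y => funext fun i => ?_⟩
  rw [hs]
  exact monomialMatrix_mulVec_apply 1 (fun _ => x) y i

/-- Since `ζ_n ^ q = ζ_d`, numbering the letters by vertices is the restriction of a linear form.
Multiplication by a `d`-th root of unity therefore means the same for letters and for vertices. -/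
theorem polygonVertex_eq_sum_letter (k : Fin (d * q)) :
    polygonVertex (d * q) k = ∑ i : Fin q, zetaRoot (d * q) ^ (i : ℕ) * letter d q k i := by
  obtain ⟨⟨j, i⟩, rfl⟩ := finProdFinEquiv.surjective k
  have hq : (q : ℂ) ≠ 0 := Nat.cast_ne_zero.2 (by have := i.2; omega)
  have hz : zetaRoot (d * q) ^ q = zetaRoot d := by
    rw [zetaRoot, zetaRoot, ← Complex.exp_nat_mul]
    congr 1
    have : (d : ℂ) ≠ 0 := Nat.cast_ne_zero.2 (NeZero.ne d)
    push_cast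
    field_simp
  rw [letter_finProdFinEquiv, Finset.sum_eq_single i (fun l _ hl => by simp [hl]) (by simp),
    Pi.single_eq_same, polygonVertex,
    show ((finProdFinEquiv (j, i) : Fin (d * q)) : ℕ) = i + q * j from rfl, pow_add, pow_mul, hz]

/-- The permutation of the letters given by a `d`-th root of unity. -/
theorem exists_rotation {x : ℂ} (hx : x ^ d = 1) :
    ∃ ρ : Equiv.Perm (Fin (d * q)), (∀ k, letter d q (ρ k) = x • letter d q k) ∧
      (∀ k, polygonVertex (d * q) (ρ k) = x * polygonVertex (d * q) k) ∧
      ∀ g, Commute ρ (embedPerm d q g) := by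
  obtain ⟨s, hs⟩ := exists_scalar (d := d) (q := q) hx
  have hl : ∀ k, letter d q (embedPerm d q s k) = x • letter d q k := fun k => by
    rw [← matrix_mulVec_letter, hs]
  refine ⟨embedPerm d q s, hl, fun k => ?_, fun g => ?_⟩
  · rw [polygonVertex_eq_sum_letter, polygonVertex_eq_sum_letter, Finset.mul_sum, hl]
    refine Finset.sum_congr rfl fun i _ => ?_
    rw [Pi.smul_apply, smul_eq_mul]
    ring
  · refine Equiv.ext fun k => letter_injective ?_
    rw [Equiv.Perm.mul_apply, Equiv.Perm.mul_apply, hl, ← matrix_mulVec_letter,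
      ← matrix_mulVec_letter, hl, Matrix.mulVec_smul]

theorem IsMuInvariant.rel_iff {n : ℕ} {P : Setoid (Fin n)} (hP : IsMuInvariant d P) {x : ℂ}
    (hx : x ^ d = 1) {ρ : Equiv.Perm (Fin n)}
    (hρ : ∀ k, polygonVertex n (ρ k) = x * polygonVertex n k) (k l : Fin n) :
    P (ρ k) (ρ l) ↔ P k l := by
  have hx0 := ne_zero_of_pow_eq_one hx
  refine ⟨hP.rel (x := x⁻¹) (by simp [hx]) ?_ ?_, hP.rel hx (hρ k) (hρ l)⟩
  · rw [hρ, inv_mul_cancel_left₀ hx0]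
  · rw [hρ, inv_mul_cancel_left₀ hx0]

theorem isMuInvariant_orbitPartition (g : monomialGroup d q) :
    IsMuInvariant d (orbitPartition d q g) := by
  rintro x hx _ ⟨_, ⟨a, rfl⟩, rfl⟩
  obtain ⟨ρ, -, hρ, hcomm⟩ := exists_rotation (d := d) (q := q) hx
  have hcg : ρ * embedPerm d q g * ρ⁻¹ = embedPerm d q g := by
    rw [(hcomm g).eq, mul_inv_cancel_right]
  convert mem_polygonParts (orbitPartition d q g) (ρ a) using 1
  ext z
  rw [Set.mem_smul_set]
  constructor
  · rintro ⟨_, ⟨k, hk, rfl⟩, rfl⟩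
    refine ⟨ρ k, ?_, hρ k⟩
    have := Equiv.Perm.SameCycle.conj (g := ρ) hk
    rwa [hcg] at this
  · rintro ⟨k, hk, rfl⟩
    refine ⟨polygonVertex (d * q) (ρ⁻¹ k), ⟨ρ⁻¹ k, ?_, rfl⟩, ?_⟩
    · change (embedPerm d q g).SameCycle _ _ at hk
      rw [← hcg, Equiv.Perm.sameCycle_conj] at hk
      rw [← Equiv.Perm.mul_apply, inv_mul_cancel, Equiv.Perm.one_apply] at hk
      exact hk
    · rw [smul_eq_mul, ← hρ, ← Equiv.Perm.mul_apply, mul_inv_cancel, Equiv.Perm.one_apply]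

/-- A permutation of the letters commuting with the multiplications by roots of unity is in the
image of `G(d,1,q)`. -/
theorem exists_embedPerm_eq {v : Equiv.Perm (Fin (d * q))}
    (hv : ∀ (x : ℂ) (k k' : Fin (d * q)), x ^ d = 1 → letter d q k' = x • letter d q k →
      letter d q (v k') = x • letter d q (v k)) :
    ∃ g, embedPerm d q g = v := by
  choose b hb using fun i : Fin q => exists_letter_eq (d := d) i (one_pow d)
  choose σ a ha hσ using fun i => exists_letter_single (v (b i))
  -- If the images of `e_i` and `e_j` lie on the same line, equivariance gives some multiple of
  -- `e_j` the same image as `e_i`, so it equals `e_i`.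
  have hinj : Function.Injective σ := by
    intro i j hij
    have hx : (a i * (a j)⁻¹) ^ d = 1 := by rw [mul_pow, inv_pow, ha, ha, inv_one, mul_one]
    obtain ⟨k, hk⟩ := exists_letter_eq (d := d) j hx
    have h1 := hv _ (b j) k hx (by rw [hk, hb, ← Pi.single_smul, smul_eq_mul, mul_one])
    rw [hσ, ← Pi.single_smul, smul_eq_mul, inv_mul_cancel_right₀ (ne_zero_of_pow_eq_one (ha j)),
      ← hij, ← hσ] at h1
    have h2 := v.injective (letter_injective h1)
    rw [h2, hb] at hk
    by_contra hne
    have := congrFun hk i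
    rw [Pi.single_eq_same, Pi.single_eq_of_ne hne] at this
    exact one_ne_zero this
  obtain ⟨g, hg⟩ := exists_matrix_eq (d := d)
    (Equiv.ofBijective σ (Finite.injective_iff_bijective.1 hinj)) ha
  refine ⟨g, Equiv.ext fun k => letter_injective ?_⟩
  obtain ⟨i, x, hx, hk⟩ := exists_letter_single k
  rw [hv x (b i) k hx (by rw [hk, hb, ← Pi.single_smul, smul_eq_mul, mul_one]), hσ,
    ← matrix_mulVec_letter, hk, hg, monomialMatrix_mulVec_single, ← Pi.single_smul, smul_eq_mul,
    mul_comm]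
  rfl

/-- Every noncrossing partition invariant under the `d`-th roots of unity is the orbit partition
of an element below the Coxeter element. -/
theorem exists_absoluteLE_orbitPartition_eq {P : Setoid (Fin (d * q))} (hP : IsNoncrossing P)
    (hμ : IsMuInvariant d P) :
    ∃ v, AbsoluteLE (monomialGroup d q) v (coxeterElement d q) ∧ orbitPartition d q v = P := by
  have hc := embedPerm_coxeterElement (d := d) (q := q)
  obtain ⟨v, hv⟩ := exists_embedPerm_eq
    (v := firstReturn (embedPerm d q (coxeterElement d q)) P) (by
      intro x k k' hx hk
      obtain ⟨ρ, hρl, hρ, hcomm⟩ := exists_rotation (d := d) (q := q) hx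
      have : k' = ρ k := letter_injective (by rw [hk, hρl])
      rw [this, firstReturn_apply_of_commute (hcomm _) (hμ.rel_iff hx hρ), hρl])
  refine ⟨v, absoluteLE_of_isArcShift ?_ (isArcShift_cyclic hc) fun k l _ =>
    sameCycle_cyclic hc k l, Setoid.ext fun k l => ?_⟩
  · rw [hv]
    exact isArcShift_firstReturn hc hP.noBlocksCross
  · change (embedPerm d q v).SameCycle k l ↔ _
    rw [hv, sameCycle_firstReturn_iff hc]

end

/-! ### The isomorphism -/

theorem mainTheorem9 (d q : ℕ) [NeZero d] [NeZero q] :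
    ∃ Φ : AbsoluteInterval (monomialGroup d q) (coxeterElement d q) ≃o NCPInvariant d q,
      ∀ w : AbsoluteInterval (monomialGroup d q) (coxeterElement d q),
        (Φ w).1.1 = orbitPartition d q w.val := by
  let φ : AbsoluteInterval (monomialGroup d q) (coxeterElement d q) → NCPInvariant d q :=
    fun w => ⟨⟨orbitPartition d q w.val,
      (isArcShift_embedPerm w.le_top).noBlocksCross.isNoncrossing⟩,
      isMuInvariant_orbitPartition w.val⟩
  have hle : ∀ v w, φ v ≤ φ w ↔ v ≤ w := fun v w =>
    ⟨fun h => absoluteLE_of_isArcShift (isArcShift_embedPerm v.le_top)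
        (isArcShift_embedPerm w.le_top) fun _ _ hkl => h hkl,
      fun h _ _ hkl => sameCycle_of_absoluteLE h w.le_top hkl⟩
  have hbij : Function.Bijective φ := by
    constructor
    -- Since orbit partitions compare exactly as the elements do, antisymmetry of the absolute order
    -- gives injectivity.
    · rintro v w h
      have h1 : v.val = w.val :=
        absoluteLE_antisymm ((hle v w).1 h.le) ((hle w v).1 h.ge)
      cases v
      cases w
      congr
    · rintro ⟨⟨P, hP⟩, hμ⟩
      obtain ⟨v, hv, rfl⟩ := exists_absoluteLE_orbitPartition_eq hP hμ
      exact ⟨⟨v, hv⟩, rfl⟩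
  exact ⟨⟨Equiv.ofBijective φ hbij, fun {v w} => hle v w⟩, fun _ => rfl⟩
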